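/- **Notation.** For real $x$ let $\langle x\rangle$ be the nearest integer to $x$, with $\langle m+\tfrac12\rangle=m$ for $m\in\mathbb Z$; for $\mu\in\mathbb C$ put $\{\mu\}=\mu-\langle\operatorname{Re}\mu\rangle$, so $-\tfrac12<\operatorname{Re}\{\mu\}\le\tfrac12$. Let $$J_\mu(z)=\Big(\frac z2\Big)^{\mu}\sum_{k\ge0}\frac{(-1)^k(z/2)^{2k}}{k!\,\Gamma(\mu+k+1)},$$ with $1/\Gamma=0$ at the poles of $\Gamma$ (for $\mu$ an integer this is an entire function of $z$). Let $P(\nu,w)=\gamma(\nu,w)/\Gamma(\nu)=w^{\nu}\gamma^*(\nu,w)$ be the normalised lower incomplete gamma function, where $\gamma^*$ is the entire function with $\gamma^*(\nu,w)=\frac1{\Gamma(\nu)}\sum_{k\ge0}\frac{(-w)^k}{(\nu+k)\,k!}$ for $\nu\ne0,-1,-2,\dots$ and $\gamma^*(-m,w)=w^m$ for $m=0,1,2,\dots$. For $\operatorname{Re}\mu\le-\tfrac12$ let $$\chi_\mu(z)=\frac{i^\mu}{\sqrt\pi}\,e^{iz}\sum_{j=1}^{-\langle\operatorname{Re}\mu\rangle}\frac{\Gamma(j+\mu-\frac12)}{\Gamma(j)\,\Gamma(j+2\mu)}\,(-2iz)^{j+\mu-1},$$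 where for $\mu=m+\tfrac12$, $m\in\{-1,-2,\dots\}$, the quotient $\Gamma(j+\mu-\tfrac12)/\Gamma(j+2\mu)$ means its limiting value $2(-1)^{m+1}\,\Gamma(-j-2m)/\Gamma(-j-m+1)$ and where $1/\Gamma(j+2\mu)=0$ if $\mu$ is a negative integer (so that $\chi_\mu=0$ then); let $\chi_\mu(z)=0$ for $\operatorname{Re}\mu>-\tfrac12$. Powers of $z/2$ and of $i$ are principal; the powers of $-iz(1+\cos\theta)$ and of $-2iz$ that occur in $P$ and in $\chi$ are taken on the branch analytic for $z\in\mathbb C\setminus(-\infty,0]$, i.e. $(-izt)^a=e^{-i\pi a/2}(zt)^a$ for $t>0$ with the principal power $(zt)^a$ (the principal branch when $-\pi/2<\arg z<\pi$). **Statement.** Let $n\ge0$ be an integer and $\mu\in\mathbb C$. Let $z\in\mathbb C$ if $\mu\in\mathbb Z$, and $z\in\mathbb C\setminus(-\infty,0]$ otherwise. Then $J_\mu$ is analytic at $z$, the integral below converges absolutely, and $$\frac{\partial^nJ_\mu}{\partial z^n}(z)=\frac{i^{\mu-n}}{\pi}\int_0^\pi e^{-iz\cos\theta}\,P\big(\{\mu\},-iz(1+\cos\theta)\big)\,(\cos\theta)^n\cos(\mu\theta)\,d\theta+\frac1{2^n}\sum_{j=0}^n(-1)^j\binom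 nj\,\chi_{\mu-n+2j}(z).$$ Moreover, if $\langle\operatorname{Re}\mu\rangle\ge n$, then the sum $\frac1{2^n}\sum_{j=0}^n(-1)^j\binom nj\chi_{\mu-n+2j}(z)$ is zero. -/

import Mathlib

open Complex

namespace BesselMixed

noncomputable section

/-- The Bessel function of the first kind
`J_μ(z) = (z/2)^μ ∑_k (-1)^k (z/2)^(2k) / (k! Γ(μ+k+1))`, with the principal power `(z/2)^μ`.
Since Mathlib's `Gamma` is `0` at its poles, `1 / Γ` is the entire reciprocal gamma function, so
the formula also gives the usual `J_μ` for `μ = -1, -2, …`. -/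
def besselJ (μ z : ℂ) : ℂ :=
  (z / 2) ^ μ *
    ∑' k : ℕ, (-1) ^ k * (z / 2) ^ (2 * k) / ((k.factorial : ℂ) * Gamma (μ + k + 1))

/-- The nearest integer `⟨x⟩` of a real number, with `⟨n + 1/2⟩ = n` for integers `n`. -/
def nearestInt (x : ℝ) : ℤ := ⌈x - 1 / 2⌉

/-- The complex fractional part `{μ} = μ - ⟨Re μ⟩`, so that `-1/2 < Re {μ} ≤ 1/2`. -/
def fracPart (μ : ℂ) : ℂ := μ - (nearestInt μ.re : ℂ)

/-- The power `w ^ a` with the branch `-3π/2 < arg w ≤ π/2`, i.e. cut along the positive imaginary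
axis. With `w = -i z t`, `t > 0`, this is the branch which is analytic for `z` in
`ℂ \ (-∞, 0]`, and `w ^ a = exp (-i π a / 2) (z t) ^ a` with the principal power of `z t`. -/
def branchPow (w a : ℂ) : ℂ := exp (-(Real.pi / 2 * I * a)) * (I * w) ^ a

/-- The branch agrees with the principal one wherever `arg w ≤ π/2`. -/
theorem branchPow_eq_cpow {w : ℂ} (a : ℂ) (hw : w.arg ≤ Real.pi / 2) :
    branchPow w a = w ^ a := by
  have hpi := Real.pi_pos
  rcases eq_or_ne w 0 with rfl | h0
  · rcases eq_or_ne a 0 with rfl | ha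
    · simp [branchPow]
    · simp [branchPow, Complex.zero_cpow ha]
  · have hlog : log (I * w) = Real.pi / 2 * I + log w := by
      rw [Complex.log_mul I_ne_zero h0, log_I]
      rw [arg_I]
      constructor <;> linarith [Complex.neg_pi_lt_arg w]
    rw [branchPow, cpow_def_of_ne_zero (mul_ne_zero I_ne_zero h0), cpow_def_of_ne_zero h0, hlog,
      ← Complex.exp_add]
    congr 1
    ring

/-- The entire incomplete gamma function `γ*(ν, w)`, that is
`(1 / Γ(ν)) ∑_k (-w)^k / ((ν + k) k!)` for `ν ≠ 0, -1, -2, …`, and `γ*(-n, w) = w ^ n`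
for natural numbers `n`. -/
def gammaStar (ν w : ℂ) : ℂ :=
  open scoped Classical in
  if h : ∃ n : ℕ, ν = -(n : ℂ) then w ^ h.choose
  else (1 / Gamma ν) * ∑' k : ℕ, (-w) ^ k / ((ν + k) * (k.factorial : ℂ))

/-- The normalised lower incomplete gamma function `P(ν, w) = γ(ν, w) / Γ(ν) = w ^ ν γ*(ν, w)`,
with the branch `-3π/2 < arg w ≤ π/2` of `w ^ ν`. -/
def gammaP (ν w : ℂ) : ℂ := branchPow w ν * gammaStar ν w

/-- The quotient `Γ(j + μ - 1/2) / Γ(j + 2μ)`, for `1 ≤ j ≤ -⟨Re μ⟩`. When `μ = m + 1/2` with `m` a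
negative integer, both gamma functions have a pole, and the quotient is replaced by its limit
`2 (-1)^(m+1) Γ(-j-2m) / Γ(-j-m+1)`. -/
def gammaQuotient (j : ℕ) (μ : ℂ) : ℂ :=
  open scoped Classical in
  let m : ℤ := nearestInt μ.re
  if μ = (m : ℂ) + 1 / 2 then
    2 * (-1) ^ (m + 1) * (Gamma (-(j : ℂ) - 2 * m) / Gamma (-(j : ℂ) - m + 1))
  else Gamma (j + μ - 1 / 2) / Gamma (j + 2 * μ)

/-- The corrective term `χ_μ(z)`. -/
def chi (μ z : ℂ) : ℂ :=
  open scoped Classical in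
  if μ.re ≤ -(1 / 2) then
    I ^ μ / (Real.sqrt Real.pi : ℂ) * exp (I * z) *
      ∑ j ∈ Finset.Icc 1 (-nearestInt μ.re).toNat,
        gammaQuotient j μ / Gamma (j : ℂ) * branchPow (-2 * I * z) (j + μ - 1)
  else 0

/-- The integrand `e^{-iz cos θ} P({μ}, -iz(1 + cos θ)) (cos θ)^n cos(μθ)`. -/
def derivIntegrand (n : ℕ) (μ z : ℂ) (θ : ℝ) : ℂ :=
  exp (-I * z * (Real.cos θ : ℂ)) *
    gammaP (fracPart μ) (-I * z * (1 + (Real.cos θ : ℂ))) *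
    (Real.cos θ : ℂ) ^ n * cos (μ * θ)

/-- The sum term `2^{-n} ∑_{j=0}^n (-1)^j C(n, j) χ_{μ-n+2j}(z)`. -/
def derivSum (n : ℕ) (μ z : ℂ) : ℂ :=
  1 / 2 ^ n * ∑ j ∈ Finset.range (n + 1), (-1) ^ j * (n.choose j : ℂ) * chi (μ - n + 2 * j) z

end

end BesselMixed

namespace BesselMixed

noncomputable section

/-! ### Binomial coefficients with complex upper argument -/

/-! Everything reduces to comparing one power series with itself, term by term. Put `N = ⟨Re μ⟩` and
`ν = {μ} = μ - N`.

Kummer's transformation gives `J_μ(z) = (z/2)^μ e^{iz} ∑_l (-iz/2)^l κ_l` with `κ_l = C(2(μ+l), l) /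
Γ(μ+l+1)` (`besselJ_eq_kummer`). On the other side `γ*(ν, w) = e^{-w} ∑_k w^k / Γ(ν+k+1)`
(`gammaStar_eq_exp_mul_tsum`), so the kernel `e^{-iz cos θ} P(ν, -iz(1+cos θ))` is `e^{iz}` times a
series in the powers `(1+cos θ)^{ν+k}` (`incGammaKernel_eq`).

Integrating termwise against `cos μθ` and writing `k = l + N`, so that `ν + k = μ + l`, leaves
Cauchy's integrals of `(1+cos θ)^{μ+l} cos μθ`. They equal `π 2^{-(μ+l)} C(2(μ+l), l)` for `l ≥ 0`
and vanish for `l < 0`. Hence for `N ≥ 0` the integral reproduces the whole Kummer series. For `N <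
0` it starts only at `l = -N`, and the missing terms `0 ≤ l < -N` are exactly `χ_μ`: by Legendre
duplication the gamma quotient in `χ_μ` is `κ_l` up to elementary factors (`chi_eq_of_ne_zero`).
This settles `n = 0` (`besselJ_eq_integral_add_chi`).

For general `n`, iterating `J_μ' = (J_{μ-1} - J_{μ+1})/2` expresses the derivative through
`J_{μ-n+2j}`. These orders differ from `μ` by integers, so they share the fractional part and hence
the kernel. The signs `(-1)^j` cancel against `i^{2j}`, and the cosines recombine into `cos^n θ cos
μθ`. -/

/-- The binomial coefficient `x (x - 1) ⋯ (x - k + 1) / k!`. -/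
def cbinom (x : ℂ) (k : ℕ) : ℂ := (descPochhammer ℂ k).eval x / k.factorial

theorem cbinom_zero (x : ℂ) : cbinom x 0 = 1 := by simp [cbinom]

theorem cbinom_natCast (n k : ℕ) : cbinom n k = n.choose k := by
  have : (k.factorial : ℂ) ≠ 0 := by exact_mod_cast k.factorial_ne_zero
  rw [cbinom, descPochhammer_eval_eq_descFactorial, Nat.descFactorial_eq_factorial_mul_choose]
  push_cast
  field_simp

theorem succ_mul_cbinom_succ (x : ℂ) (k : ℕ) :
    (k + 1) * cbinom x (k + 1) = (x - k) * cbinom x k := by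
  have : (k.factorial : ℂ) ≠ 0 := by exact_mod_cast k.factorial_ne_zero
  have h2 : (k + 1 : ℂ) ≠ 0 := by exact_mod_cast k.succ_ne_zero
  rw [cbinom, cbinom, descPochhammer_succ_eval, Nat.factorial_succ]
  push_cast
  field_simp

-- Compare coefficients of `X^p` in `(1+X)^{2n} = (X(X+2)+1)^n`. Truncated subtraction in the
-- exponent of 2 is harmless, since the second binomial coefficient vanishes when `x.2 > x.1`.
open Polynomial in
theorem choose_two_mul_eq_sum (n p : ℕ) :
    (2 * n).choose p = ∑ x ∈ Finset.HasAntidiagonal.antidiagonal p,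
      n.choose x.1 * (2 ^ (x.1 - x.2) * x.1.choose x.2) := by
  have key : ((1 + X : ℕ[X]) ^ (2 * n)) = (X * (X + C 2) + 1) ^ n := by
    rw [pow_mul]
    congr 1
    simp only [map_ofNat]
    ring
  have h := congrArg (fun q => q.coeff p) key
  simp only [coeff_one_add_X_pow] at h
  rw [add_pow] at h
  simp only [finsetSum_coeff, one_pow, mul_one, mul_pow, coeff_mul_natCast] at h
  rw [Nat.cast_id] at h
  rw [h, Finset.Nat.sum_antidiagonal_eq_sum_range_succ
    (f := fun i k => n.choose i * (2 ^ (i - k) * i.choose k))]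
  have hc : ∀ i, ((X : ℕ[X]) ^ i * (X + C 2) ^ i).coeff p =
      if i ≤ p then 2 ^ (i - (p - i)) * i.choose (p - i) else 0 := by
    intro i
    rw [coeff_X_pow_mul']
    split_ifs
    · rw [coeff_X_add_C_pow, Nat.cast_id]
    · rfl
  simp only [hc, Nat.cast_id]
  -- The binomial theorem sums over `i ≤ n`, the antidiagonal over `i ≤ p`; both extend by zero to
  -- `i ≤ max n p`.
  have e1 : ∑ i ∈ Finset.range (n + 1),
      (if i ≤ p then 2 ^ (i - (p - i)) * i.choose (p - i) else 0) * n.choose i =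
      ∑ i ∈ Finset.range (max n p + 1),
      (if i ≤ p then 2 ^ (i - (p - i)) * i.choose (p - i) else 0) * n.choose i := by
    refine Finset.sum_subset (by intro i; simp; omega) fun i _ hi => ?_
    rw [Nat.choose_eq_zero_of_lt (n := n) (by simpa using hi), mul_zero]
  have e2 : ∑ i ∈ Finset.range (p + 1),
      (if i ≤ p then 2 ^ (i - (p - i)) * i.choose (p - i) else 0) * n.choose i =
      ∑ i ∈ Finset.range (max n p + 1),
      (if i ≤ p then 2 ^ (i - (p - i)) * i.choose (p - i) else 0) * n.choose i := by
    refine Finset.sum_subset (by intro i; simp; omega) fun i _ hi => ?_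
    rw [if_neg (by simp at hi; omega), zero_mul]
  rw [e1, ← e2]
  refine Finset.sum_congr rfl fun i hi => ?_
  rw [if_pos (by simp at hi; omega), mul_comm]

-- Both sides are polynomials in `x`, and they agree at every natural number.
open Polynomial in
theorem cbinom_two_mul (x : ℂ) (p : ℕ) :
    cbinom (2 * x) p = ∑ y ∈ Finset.HasAntidiagonal.antidiagonal p,
      cbinom x y.1 * (2 ^ (y.1 - y.2) * (y.1.choose y.2 : ℂ)) := by
  let P : ℂ[X] := C ((p.factorial : ℂ)⁻¹) * (descPochhammer ℂ p).comp (C 2 * X)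
  let Q : ℂ[X] := ∑ y ∈ Finset.HasAntidiagonal.antidiagonal p,
      C ((y.1.factorial : ℂ)⁻¹) * descPochhammer ℂ y.1 * C (2 ^ (y.1 - y.2) * (y.1.choose y.2 : ℂ))
  have hP : ∀ x, P.eval x = cbinom (2 * x) p := fun x => by
    simp [P, cbinom, eval_comp]; ring
  have hQ : ∀ x, Q.eval x = ∑ y ∈ Finset.HasAntidiagonal.antidiagonal p,
      cbinom x y.1 * (2 ^ (y.1 - y.2) * (y.1.choose y.2 : ℂ)) := fun x => by
    simp only [Q, cbinom, eval_finsetSum, eval_mul, eval_C]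
    refine Finset.sum_congr rfl fun i _ => ?_
    ring
  have hPQ : P = Q := by
    refine eq_of_infinite_eval_eq _ _ ((Set.infinite_range_of_injective
      (Nat.cast_injective (R := ℂ))).mono ?_)
    rintro _ ⟨n, rfl⟩
    simp only [Set.mem_ofPred_eq, hP, hQ, cbinom_natCast]
    have := congrArg (Nat.cast (R := ℂ)) (choose_two_mul_eq_sum n p)
    rw [← cbinom_natCast] at this
    push_cast at this
    exact this
  rw [← hP, hPQ, hQ]

/-! ### The reciprocal gamma function -/

theorem inv_Gamma_eq_mul (s : ℂ) : (Gamma s)⁻¹ = s * (Gamma (s + 1))⁻¹ := by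
  simpa using one_div_Gamma_eq_self_mul_one_div_Gamma_add_one s

/-- Iterates `1/Γ(s) = s/Γ(s+1)`; since `1/Γ` is entire, no exceptional `s` has to be excluded. -/
theorem descPochhammer_eval_mul_inv_Gamma (s : ℂ) (i : ℕ) :
    (descPochhammer ℂ i).eval s * (Gamma (s + 1))⁻¹ = (Gamma (s - i + 1))⁻¹ := by
  induction i with
  | zero => simp
  | succ i ih =>
    rw [descPochhammer_succ_eval, mul_right_comm, ih, mul_comm]
    have := inv_Gamma_eq_mul (s - i)
    rw [← this]
    push_cast
    ring_nf

theorem summable_norm_pow_mul_inv_Gamma (μ w : ℂ) :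
    Summable fun k : ℕ => ‖w ^ k * (Gamma (μ + k + 1))⁻¹‖ := by
  refine summable_of_ratio_norm_eventually_le (r := 1 / 2) (by norm_num) ?_
  -- The ratio of consecutive terms is `w / (μ+k+1)`; beyond this `K` its norm is at most `1/2`.
  obtain ⟨K, hK⟩ := exists_nat_gt (2 * ‖w‖ + ‖μ + 1‖)
  filter_upwards [Filter.eventually_ge_atTop K] with k hk
  have hk' : 2 * ‖w‖ ≤ ‖μ + k + 1‖ := by
    have h1 : ‖(k : ℂ)‖ ≤ ‖μ + k + 1‖ + ‖μ + 1‖ := by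
      have := norm_sub_le (μ + k + 1) (μ + 1)
      rwa [show μ + k + 1 - (μ + 1) = k by ring] at this
    rw [Complex.norm_natCast] at h1
    have : (K : ℝ) ≤ k := by exact_mod_cast hk
    linarith
  rw [inv_Gamma_eq_mul (μ + k + 1)]
  push_cast
  rw [← add_assoc μ]
  simp only [norm_norm, norm_mul, pow_succ]
  have h3 := norm_nonneg (w ^ k)
  have h4 := norm_nonneg ((Gamma (μ + k + 1 + 1))⁻¹)
  nlinarith [mul_nonneg h3 h4]

theorem summable_norm_pow_div_factorial_mul_Gamma (μ w : ℂ) :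
    Summable fun k : ℕ => ‖w ^ k / ((k.factorial : ℂ) * Gamma (μ + k + 1))‖ := by
  refine Summable.of_nonneg_of_le (fun _ => norm_nonneg _) (fun k => ?_)
    (summable_norm_pow_mul_inv_Gamma μ w)
  have : (1 : ℝ) ≤ k.factorial := by exact_mod_cast k.factorial_pos
  rw [div_eq_mul_inv, mul_inv, norm_mul, norm_mul, norm_mul, norm_inv (k.factorial : ℂ),
    Complex.norm_natCast]
  have h2 : (k.factorial : ℝ)⁻¹ ≤ 1 := inv_le_one_of_one_le₀ this
  gcongr
  exact mul_le_of_le_one_left (norm_nonneg _) h2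

theorem summable_norm_pow_div_factorial (w : ℂ) :
    Summable fun k : ℕ => ‖w ^ k / (k.factorial : ℂ)‖ :=
  NormedSpace.norm_expSeries_div_summable w

theorem exp_eq_tsum_div (w : ℂ) : exp w = ∑' k : ℕ, w ^ k / (k.factorial : ℂ) := by
  rw [Complex.exp_eq_exp_ℂ, NormedSpace.exp_eq_tsum_div]

/-! ### Pascal-type recursions -/

/-- A Pascal-type recursion is solved by the binomial sum. -/
theorem eq_sum_choose_of_recursion {G : ℕ → ℂ → ℂ} {S : Set ℂ} {σ u v : ℂ}
    (hu : ∀ x ∈ S, x + u ∈ S) (hv : ∀ x ∈ S, x + v ∈ S)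
    (h : ∀ n, ∀ x ∈ S, G (n + 1) x = G n (x + u) + σ * G n (x + v)) (n : ℕ) :
    ∀ x ∈ S, G n x = ∑ j ∈ Finset.range (n + 1),
      σ ^ j * (n.choose j : ℂ) * G 0 (x + (n - j) * u + j * v) := by
  induction n with
  | zero => intro x _; simp
  | succ n ih =>
    intro x hx
    rw [h n x hx, ih _ (hu x hx), ih _ (hv x hx)]
    set f : ℕ → ℂ := fun j => G 0 (x + ((n + 1 : ℕ) - j) * u + j * v) with hf
    have h1 : ∑ j ∈ Finset.range (n + 1),
        σ ^ j * (n.choose j : ℂ) * G 0 (x + u + (n - j) * u + j * v) =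
        ∑ j ∈ Finset.range (n + 1), σ ^ j * (n.choose j : ℂ) * f j := by
      refine Finset.sum_congr rfl fun j _ => ?_
      simp only [hf]
      congr 2
      push_cast
      ring
    have h2 : σ * ∑ j ∈ Finset.range (n + 1),
        σ ^ j * (n.choose j : ℂ) * G 0 (x + v + (n - j) * u + j * v) =
        ∑ j ∈ Finset.range (n + 1), σ ^ (j + 1) * (n.choose j : ℂ) * f (j + 1) := by
      rw [Finset.mul_sum]
      refine Finset.sum_congr rfl fun j _ => ?_
      simp only [hf, pow_succ']
      rw [show x + v + (n - j) * u + j * v =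
        x + ((n + 1 : ℕ) - (j + 1 : ℕ)) * u + (j + 1 : ℕ) * v by push_cast; ring]
      ring
    have h3 : ∑ j ∈ Finset.range (n + 1), σ ^ j * (n.choose j : ℂ) * f j =
        ∑ j ∈ Finset.range (n + 1), σ ^ (j + 1) * (n.choose (j + 1) : ℂ) * f (j + 1) + f 0 := by
      have := Finset.sum_range_succ' (fun j => σ ^ j * (n.choose j : ℂ) * f j) (n + 1)
      rw [Finset.sum_range_succ] at this
      simpa using this
    rw [h1, h2, h3, Finset.sum_range_succ' _ (n + 1), add_right_comm, ← Finset.sum_add_distrib]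
    congr 1
    · refine Finset.sum_congr rfl fun j _ => ?_
      change _ = σ ^ (j + 1) * ((n + 1).choose (j + 1) : ℂ) * f (j + 1)
      rw [Nat.choose_succ_succ']
      push_cast
      ring
    · simp [hf]

/-! ### Kummer's transformation of the Bessel series -/

/-- The coefficients of `(-i z / 2) ^ l` in `e^{-iz} (z / 2)^{-μ} J_μ(z)`. -/
def kummerCoeff (μ : ℂ) (l : ℕ) : ℂ := cbinom (2 * (μ + l)) l * (Gamma (μ + l + 1))⁻¹

/-- The power series coefficients of `(z / 2)^{-μ} I_μ(z)` in `z / 2`. -/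
def evenCoeff (μ : ℂ) (m : ℕ) : ℂ :=
  if Even m then 1 / (((m / 2).factorial : ℂ) * Gamma (μ + (m / 2 : ℕ) + 1)) else 0

/-- This is the Cauchy product of `e^{2x}` with the even Bessel series, read off at `x^p`. After
expanding `C(2(μ+p), p)` by `cbinom_two_mul`, the factor `1/Γ(μ+p+1)` absorbs each falling factorial
and becomes `1/Γ(μ+k+1)`. -/
theorem kummerCoeff_eq_sum (μ : ℂ) (p : ℕ) :
    kummerCoeff μ p = ∑ y ∈ Finset.HasAntidiagonal.antidiagonal p,
      2 ^ y.1 / (y.1.factorial : ℂ) * evenCoeff μ y.2 := by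
  rw [kummerCoeff, cbinom_two_mul, Finset.sum_mul]
  have hL : ∀ y ∈ Finset.HasAntidiagonal.antidiagonal p,
      cbinom (μ + p) y.1 * (2 ^ (y.1 - y.2) * (y.1.choose y.2 : ℂ)) * (Gamma (μ + p + 1))⁻¹ =
      if y.2 ≤ y.1 then 2 ^ (y.1 - y.2) / ((y.1 - y.2).factorial : ℂ) *
        (1 / ((y.2.factorial : ℂ) * Gamma (μ + y.2 + 1))) else 0 := by
    rintro ⟨i, k⟩ hik
    rw [Finset.HasAntidiagonal.mem_antidiagonal] at hik
    simp only at hik ⊢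
    split_ifs with hki
    · have h1 := descPochhammer_eval_mul_inv_Gamma (μ + p) i
      have h2 : μ + p - i + 1 = μ + k + 1 := by
        rw [← hik]; push_cast; ring
      rw [h2] at h1
      have h3 : (i.choose k : ℂ) * k.factorial * (i - k).factorial = i.factorial := by
        exact_mod_cast Nat.choose_mul_factorial_mul_factorial hki
      have f1 : (i.factorial : ℂ) ≠ 0 := by exact_mod_cast i.factorial_ne_zero
      have f2 : (k.factorial : ℂ) ≠ 0 := by exact_mod_cast k.factorial_ne_zero
      have f3 : ((i - k).factorial : ℂ) ≠ 0 := by exact_mod_cast (i - k).factorial_ne_zero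
      have h4 : (i.choose k : ℂ) / i.factorial = 1 / (k.factorial * (i - k).factorial) := by
        rw [div_eq_div_iff f1 (mul_ne_zero f2 f3), one_mul, ← mul_assoc, h3]
      calc _ = ((descPochhammer ℂ i).eval (μ + p) * (Gamma (μ + p + 1))⁻¹) * 2 ^ (i - k) *
            ((i.choose k : ℂ) / i.factorial) := by rw [cbinom]; ring
        _ = _ := by rw [h1, h4]; field_simp
    · rw [Nat.choose_eq_zero_of_lt (by omega)]
      simp
  have hR : ∀ y ∈ Finset.HasAntidiagonal.antidiagonal p,
      2 ^ y.1 / (y.1.factorial : ℂ) * evenCoeff μ y.2 = if Even y.2 then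
        2 ^ y.1 / (y.1.factorial : ℂ) *
          (1 / (((y.2 / 2).factorial : ℂ) * Gamma (μ + (y.2 / 2 : ℕ) + 1))) else 0 := by
    intro y _
    rw [evenCoeff, mul_ite, mul_zero]
  rw [Finset.sum_congr rfl hL, Finset.sum_congr rfl hR, ← Finset.sum_filter, ← Finset.sum_filter]
  -- A nonzero term `(i, k)` on the left, `k ≤ i`, is the product of the exponential term of degree
  -- `i - k` with the even term of degree `2k`.
  refine Finset.sum_nbij' (fun y => (y.1 - y.2, 2 * y.2)) (fun y => (y.1 + y.2 / 2, y.2 / 2))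
    ?_ ?_ ?_ ?_ ?_
  · rintro ⟨i, k⟩ h
    simp only [Finset.mem_filter, Finset.HasAntidiagonal.mem_antidiagonal] at h ⊢
    exact ⟨by omega, even_two_mul k⟩
  · rintro ⟨i, k⟩ h
    simp only [Finset.mem_filter, Finset.HasAntidiagonal.mem_antidiagonal, even_iff_two_dvd] at h ⊢
    constructor <;> omega
  · rintro ⟨i, k⟩ h
    simp only [Finset.mem_filter, Finset.HasAntidiagonal.mem_antidiagonal, Prod.mk.injEq] at h ⊢
    constructor <;> omega
  · rintro ⟨i, k⟩ h
    simp only [Finset.mem_filter, Finset.HasAntidiagonal.mem_antidiagonal, even_iff_two_dvd, Prod.mk.injEq] at h ⊢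
    constructor <;> omega
  · rintro ⟨i, k⟩ h
    simp

/-- Used at `x = -iz/2`, where `x² = -(z/2)²` and `e^{2x} = e^{-iz}`. -/
theorem kummer_transformation (μ x : ℂ) :
    (Summable fun p : ℕ => ‖x ^ p * kummerCoeff μ p‖) ∧
    ∑' p : ℕ, x ^ p * kummerCoeff μ p =
      exp (2 * x) * ∑' k : ℕ, (x ^ 2) ^ k / ((k.factorial : ℂ) * Gamma (μ + k + 1)) := by
  have hinj : Function.Injective (fun k : ℕ => 2 * k) := mul_right_injective₀ two_ne_zero
  have hsupp : ∀ m ∉ Set.range (fun k : ℕ => 2 * k), x ^ m * evenCoeff μ m = 0 := by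
    intro m hm
    rw [evenCoeff, if_neg, mul_zero]
    rintro ⟨k, hk⟩
    exact hm ⟨k, by simp only; omega⟩
  have hcomp : ∀ k : ℕ, x ^ (2 * k) * evenCoeff μ (2 * k) =
      (x ^ 2) ^ k / ((k.factorial : ℂ) * Gamma (μ + k + 1)) := by
    intro k
    simp [evenCoeff, pow_mul, div_eq_mul_inv]
  have hs2 : Summable fun m : ℕ => ‖x ^ m * evenCoeff μ m‖ := by
    rw [← hinj.summable_iff (fun m hm => by rw [hsupp m hm, norm_zero])]
    simpa only [Function.comp_def, hcomp] using
      summable_norm_pow_div_factorial_mul_Gamma μ (x ^ 2)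
  have ht2 : ∑' m : ℕ, x ^ m * evenCoeff μ m =
      ∑' k : ℕ, (x ^ 2) ^ k / ((k.factorial : ℂ) * Gamma (μ + k + 1)) := by
    rw [← hinj.tsum_eq (f := fun m => x ^ m * evenCoeff μ m)]
    · exact tsum_congr hcomp
    · intro m hm
      by_contra h
      exact hm (hsupp m h)
  have hs1 := summable_norm_pow_div_factorial (2 * x)
  have hterm : ∀ p : ℕ, ∑ y ∈ Finset.HasAntidiagonal.antidiagonal p,
      (2 * x) ^ y.1 / (y.1.factorial : ℂ) * (x ^ y.2 * evenCoeff μ y.2) =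
      x ^ p * kummerCoeff μ p := by
    intro p
    rw [kummerCoeff_eq_sum, Finset.mul_sum]
    refine Finset.sum_congr rfl fun y hy => ?_
    rw [← Finset.HasAntidiagonal.mem_antidiagonal.1 hy, pow_add, mul_pow]
    ring
  constructor
  · simpa only [hterm] using summable_norm_sum_mul_antidiagonal_of_summable_norm hs1 hs2
  · rw [← ht2, exp_eq_tsum_div, tsum_mul_tsum_eq_tsum_sum_antidiagonal_of_summable_norm hs1 hs2]
    exact (tsum_congr hterm).symm

/-! ### The entire incomplete gamma function -/

/-- The left side is an iterated difference of `1/x`; the right side satisfies `G_{n+1}(x) = G_n(x)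
- G_n(x+1)` with `G_0(x) = Γ(x)/Γ(x+1) = 1/x`. -/
theorem sum_choose_div_add (n : ℕ) {x : ℂ} (hx : ∀ m : ℕ, x ≠ -m) :
    ∑ j ∈ Finset.range (n + 1), (-1) ^ j * (n.choose j : ℂ) * (x + j)⁻¹ =
      n.factorial * Gamma x * (Gamma (x + n + 1))⁻¹ := by
  have h := eq_sum_choose_of_recursion (S := {x : ℂ | ∀ m : ℕ, x ≠ -m}) (σ := -1) (u := 0) (v := 1)
    (G := fun n x => n.factorial * Gamma x * (Gamma (x + n + 1))⁻¹) (by simp) ?_ ?_ n x hx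
  · rw [h]
    refine Finset.sum_congr rfl fun j _ => ?_
    have hxj : ∀ m : ℕ, x + j ≠ -m := fun m h => hx (j + m) (by
      push_cast; linear_combination h)
    have h0 := hxj 0
    simp only [Nat.cast_zero, neg_zero] at h0
    have hG := Gamma_ne_zero hxj
    simp only [mul_zero, add_zero, mul_one, Nat.factorial_zero, Nat.cast_one, one_mul, Nat.cast_zero]
    rw [Gamma_add_one _ h0]
    field_simp
  · intro x hx m h
    exact hx (m + 1) (by push_cast; linear_combination h)
  · intro n x hx
    have h0 := hx 0
    simp only [Nat.cast_zero, neg_zero] at h0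
    simp only [add_zero]
    rw [Gamma_add_one x h0, inv_Gamma_eq_mul (x + n + 1), Nat.factorial_succ]
    push_cast
    rw [show x + 1 + n + 1 = x + n + 1 + 1 by ring, show x + (n + 1) + 1 = x + n + 1 + 1 by ring]
    ring

/-- Multiply the defining series by `e^w`: the Cauchy product has the sums of `sum_choose_div_add`
as coefficients. The value `ν = 0` is needed for integer orders and is treated apart. -/
theorem gammaStar_eq_exp_mul_tsum {ν : ℂ} (hν : ∀ m : ℕ, ν ≠ -(m + 1)) (w : ℂ) :
    gammaStar ν w = exp (-w) * ∑' k : ℕ, w ^ k * (Gamma (ν + k + 1))⁻¹ := by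
  rw [gammaStar]
  split_ifs with h
  · have h0 : h.choose = 0 := by
      by_contra hne
      obtain ⟨m, hm⟩ := Nat.exists_eq_succ_of_ne_zero hne
      refine hν m ?_
      have := h.choose_spec
      rw [hm] at this
      rw [this]
      push_cast
      ring
    have hν0 : ν = 0 := by simpa [h0] using h.choose_spec
    rw [h0, hν0, pow_zero]
    have : ∀ k : ℕ, w ^ k * (Gamma (0 + k + 1))⁻¹ = w ^ k / (k.factorial : ℂ) := by
      intro k
      rw [zero_add, Gamma_nat_eq_factorial, div_eq_mul_inv]
    rw [tsum_congr this, ← exp_eq_tsum_div, ← exp_add]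
    simp
  · have hν' : ∀ m : ℕ, ν ≠ -m := fun m hm => h ⟨m, hm⟩
    have hs1 := summable_norm_pow_div_factorial w
    have hs2 : Summable fun k : ℕ => ‖(-w) ^ k / ((ν + k) * (k.factorial : ℂ))‖ := by
      obtain ⟨K, hK⟩ := exists_nat_gt (1 + ‖ν‖)
      refine Summable.of_norm_bounded_eventually_nat (summable_norm_pow_div_factorial w) ?_
      filter_upwards [Filter.eventually_ge_atTop K] with k hk
      have hk' : 1 ≤ ‖ν + k‖ := by
        have h1 : ‖(k : ℂ)‖ ≤ ‖ν + k‖ + ‖ν‖ := by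
          have := norm_sub_le (ν + k) ν
          rwa [add_sub_cancel_left] at this
        rw [Complex.norm_natCast] at h1
        have : (K : ℝ) ≤ k := by exact_mod_cast hk
        linarith
      rw [norm_norm, norm_div, norm_div, norm_mul, norm_pow, norm_pow, norm_neg]
      have hf : (0 : ℝ) < ‖(k.factorial : ℂ)‖ := by
        rw [Complex.norm_natCast]; exact_mod_cast k.factorial_pos
      gcongr
      exact le_mul_of_one_le_left hf.le hk'
    have key : exp w * ∑' k : ℕ, (-w) ^ k / ((ν + k) * (k.factorial : ℂ)) =
        Gamma ν * ∑' k : ℕ, w ^ k * (Gamma (ν + k + 1))⁻¹ := by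
      rw [mul_comm, exp_eq_tsum_div, tsum_mul_tsum_eq_tsum_sum_antidiagonal_of_summable_norm hs2 hs1,
        ← tsum_mul_left]
      refine tsum_congr fun p => ?_
      have hp := sum_choose_div_add p hν'
      have f0 : (p.factorial : ℂ) ≠ 0 := by exact_mod_cast p.factorial_ne_zero
      have : Gamma ν * (w ^ p * (Gamma (ν + p + 1))⁻¹) =
          w ^ p / p.factorial * (p.factorial * Gamma ν * (Gamma (ν + p + 1))⁻¹) := by
        field_simp
      rw [this, ← hp, Finset.mul_sum, Finset.Nat.sum_antidiagonal_eq_sum_range_succ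
        (f := fun i j => (-w) ^ i / ((ν + i) * (i.factorial : ℂ)) * (w ^ j / (j.factorial : ℂ)))]
      refine Finset.sum_congr rfl fun j hj => ?_
      have hjp : j ≤ p := by simp at hj; omega
      have h3 : (p.choose j : ℂ) * j.factorial * (p - j).factorial = p.factorial := by
        exact_mod_cast Nat.choose_mul_factorial_mul_factorial hjp
      have f2 : (j.factorial : ℂ) ≠ 0 := by exact_mod_cast j.factorial_ne_zero
      have f3 : ((p - j).factorial : ℂ) ≠ 0 := by exact_mod_cast (p - j).factorial_ne_zero
      have h4 : (p.choose j : ℂ) / p.factorial = 1 / (j.factorial * (p - j).factorial) := by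
        rw [div_eq_div_iff f0 (mul_ne_zero f2 f3), one_mul, ← mul_assoc, h3]
      calc _ = (-1) ^ j * (w ^ j * w ^ (p - j)) * (ν + j)⁻¹ *
            (1 / (j.factorial * (p - j).factorial)) := by
            rw [neg_pow w, div_eq_mul_inv, mul_inv]; field_simp
        _ = _ := by rw [← h4, ← pow_add, Nat.add_sub_cancel' hjp]; ring
    have hG := Gamma_ne_zero hν'
    rw [exp_neg, eq_inv_mul_iff_mul_eq₀ (exp_ne_zero w), mul_left_comm, key]
    field_simp

/-! ### Complex powers and the chosen branch -/

theorem ofReal_mul_cpow {r : ℝ} (hr : 0 ≤ r) (z a : ℂ) :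
    ((r : ℂ) * z) ^ a = (r : ℂ) ^ a * z ^ a := by
  rcases eq_or_ne a 0 with rfl | ha
  · simp
  rcases eq_or_ne z 0 with rfl | hz
  · simp [zero_cpow ha]
  rcases hr.eq_or_lt with rfl | hr
  · simp [zero_cpow ha]
  have hr' : (r : ℂ) ≠ 0 := ofReal_ne_zero.2 hr.ne'
  rw [cpow_def_of_ne_zero (mul_ne_zero hr' hz), log_ofReal_mul hr hz, ofReal_log hr.le,
    add_mul, exp_add, ← cpow_def_of_ne_zero hr', ← cpow_def_of_ne_zero hz]

theorem I_cpow (a : ℂ) : I ^ a = exp (Real.pi / 2 * I * a) := by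
  rw [cpow_def_of_ne_zero I_ne_zero, log_I]

/-- Since `I * (-I * z) = z`, the rotated branch turns into the principal power of `z`, with no
restriction on `z`. -/
theorem branchPow_neg_I_mul (z a : ℂ) : branchPow (-I * z) a = I ^ (-a) * z ^ a := by
  rw [branchPow, I_cpow]
  congr 2
  · ring
  · rw [← mul_assoc, mul_neg, I_mul_I]
    ring

theorem two_cpow_ne_zero (a : ℂ) : (2 : ℂ) ^ a ≠ 0 := by
  simp [cpow_eq_zero_iff]

theorem div_two_cpow (z a : ℂ) : (z / 2) ^ a = z ^ a / 2 ^ a := by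
  have := ofReal_mul_cpow zero_le_two (z / 2) a
  rw [ofReal_ofNat, mul_div_cancel₀ _ two_ne_zero] at this
  rw [this, mul_div_cancel_left₀ _ (two_cpow_ne_zero a)]

/-! ### The corrective term as a partial sum of Kummer's series -/

theorem nearestInt_intCast (m : ℤ) : nearestInt m = m := by
  rw [nearestInt, Int.ceil_eq_iff]
  constructor <;> linarith

theorem nearestInt_intCast_add_half (m : ℤ) : nearestInt (m + 1 / 2) = m := by
  rw [nearestInt, Int.ceil_eq_iff]
  constructor <;> linarith

theorem nearestInt_add_intCast (x : ℝ) (m : ℤ) : nearestInt (x + m) = nearestInt x + m := by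
  rw [nearestInt, nearestInt, ← Int.ceil_add_intCast]
  ring_nf

theorem inv_Gamma_neg_natCast (n : ℕ) : (Gamma (-n : ℂ))⁻¹ = 0 := by
  rw [Gamma_neg_nat_eq_zero, inv_zero]

theorem factorial_mul_cbinom (x : ℂ) (k : ℕ) :
    (k.factorial : ℂ) * cbinom x k = (descPochhammer ℂ k).eval x := by
  have : (k.factorial : ℂ) ≠ 0 := by exact_mod_cast k.factorial_ne_zero
  rw [cbinom]
  field_simp

theorem sqrt_pi_ne_zero : ((Real.sqrt Real.pi : ℝ) : ℂ) ≠ 0 :=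
  ofReal_ne_zero.2 (Real.sqrt_pos.2 Real.pi_pos).ne'

/-- Legendre's duplication formula in terms of Kummer's coefficients. -/
theorem Gamma_div_Gamma_mul_two_cpow {μ : ℂ} (l : ℕ) (h : ∀ m : ℤ, 2 * μ ≠ m) :
    Gamma (l + 1 + μ - 1 / 2) / Gamma (l + 1 + 2 * μ) * 2 ^ (2 * (μ + l)) =
      Real.sqrt Real.pi * (l.factorial * kummerCoeff μ l) := by
  have hdup := Gamma_mul_Gamma_add_half (μ + l + 1 / 2)
  rw [show μ + l + 1 / 2 + 1 / 2 = μ + l + 1 by ring,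
    show 2 * (μ + l + 1 / 2) = 2 * (μ + l) + 1 by ring,
    show 1 - (2 * (μ + l) + 1) = -(2 * (μ + l)) by ring, cpow_neg] at hdup
  have hdesc := descPochhammer_eval_mul_inv_Gamma (2 * (μ + l)) l
  have g1 : Gamma (μ + l + 1) ≠ 0 := Gamma_ne_zero fun m hm =>
    h (2 * (-m - l - 1)) (by push_cast; linear_combination 2 * hm)
  have g2 : Gamma (2 * (μ + l) + 1) ≠ 0 := Gamma_ne_zero fun m hm =>
    h (-m - 2 * l - 1) (by push_cast; linear_combination hm)
  rw [kummerCoeff, ← mul_assoc (l.factorial : ℂ), factorial_mul_cbinom,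
    show (l : ℂ) + 1 + μ - 1 / 2 = μ + l + 1 / 2 by ring,
    show (l : ℂ) + 1 + 2 * μ = 2 * (μ + l) - l + 1 by ring, div_eq_mul_inv, ← hdesc]
  have h2 := two_cpow_ne_zero (2 * (μ + l))
  generalize (descPochhammer ℂ l).eval (2 * (μ + l)) = D at *
  generalize Gamma (2 * (μ + l) + 1) = A at *
  generalize Gamma (μ + l + 1) = B at *
  generalize Gamma (μ + l + 1 / 2) = C at *
  generalize (2 : ℂ) ^ (2 * (μ + l)) = E at *
  field_simp at hdup ⊢
  linear_combination D * hdup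

theorem Gamma_half_sub_natCast (q : ℕ) :
    Gamma (1 / 2 - q) * (2 * q).factorial = (-4) ^ q * q.factorial * Real.sqrt Real.pi := by
  induction q with
  | zero =>
    simp only [Nat.cast_zero, sub_zero, mul_zero, Nat.factorial_zero, Nat.cast_one, mul_one,
      pow_zero, one_mul]
    rw [Gamma_one_half_eq, Real.sqrt_eq_rpow, ofReal_cpow Real.pi_pos.le]
    simp
  | succ q ih =>
    have h := Gamma_add_one (1 / 2 - (q + 1 : ℕ) : ℂ) (by
      intro h
      have h2 : ((1 : ℕ) : ℂ) = ((2 * (q + 1) : ℕ) : ℂ) := by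
        push_cast at h ⊢; linear_combination 2 * h
      have := Nat.cast_injective h2
      omega)
    rw [show (1 / 2 - (q + 1 : ℕ) + 1 : ℂ) = 1 / 2 - q by push_cast; ring] at h
    rw [h] at ih
    rw [show 2 * (q + 1) = 2 * q + 1 + 1 by ring, Nat.factorial_succ, Nat.factorial_succ,
      Nat.factorial_succ, pow_succ]
    push_cast at ih ⊢
    linear_combination (-4 * (q + 1)) * ih

theorem descPochhammer_eval_neg_natCast_mul (a l : ℕ) :
    (descPochhammer ℂ l).eval (-(a + 1 : ℂ)) * a.factorial = (-1) ^ l * (a + l).factorial := by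
  induction l with
  | zero => simp
  | succ l ih =>
    rw [descPochhammer_succ_eval, ← add_assoc, Nat.factorial_succ, pow_succ]
    push_cast
    linear_combination (-(a + 1 : ℂ) - l) * ih

/-- The reason why `χ_μ` is a piece of Kummer's series. Duplication gives the case `2μ ∉ ℤ`; for
half-integers the prescribed limiting value is checked by factorials; for negative integers both
sides are zero. -/
theorem gammaQuotient_mul_two_cpow {μ : ℂ} {l : ℕ} (hl : l < (-nearestInt μ.re).toNat) :
    gammaQuotient (l + 1) μ * 2 ^ (2 * (μ + l)) =
      Real.sqrt Real.pi * (l.factorial * kummerCoeff μ l) := by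
  have hl' : (l : ℤ) < -nearestInt μ.re := by omega
  simp only [gammaQuotient]
  split_ifs with h
  · obtain ⟨q, hq⟩ : ∃ q : ℕ, nearestInt μ.re = -(q + l + 1 : ℤ) :=
      ⟨(-nearestInt μ.re - l - 1).toNat, by omega⟩
    rw [hq] at h ⊢
    have hD := descPochhammer_eval_neg_natCast_mul (2 * q) l
    have hG := Gamma_half_sub_natCast q
    have e1 : 2 * (μ + l) = -((2 * q : ℕ) + 1 : ℂ) := by rw [h]; push_cast; ring
    have e2 : μ + l + 1 = 1 / 2 - q := by rw [h]; push_cast; ring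
    have e3 : (-((l + 1 : ℕ) : ℂ) - 2 * (-(q + l + 1 : ℤ) : ℤ)) = ((2 * q + l : ℕ) : ℂ) + 1 := by
      push_cast; ring
    have e4 : (-((l + 1 : ℕ) : ℂ) - (-(q + l + 1 : ℤ) : ℤ) + 1) = (q : ℂ) + 1 := by
      push_cast; ring
    have e5 : ((-1 : ℂ) ^ (-(q + l + 1 : ℤ) + 1)) = (-1) ^ q * (-1) ^ l := by
      rw [show (-(q + l + 1 : ℤ) + 1) = -((q + l : ℕ) : ℤ) by push_cast; ring, zpow_neg,
        zpow_natCast, ← pow_add, ← inv_pow, inv_neg, inv_one]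
    have e6 : (2 : ℂ) ^ (-((2 * q : ℕ) + 1 : ℂ)) = (2 * 4 ^ q)⁻¹ := by
      rw [cpow_neg, ← Nat.cast_succ, cpow_natCast, pow_succ, pow_mul]
      norm_num
      ring
    rw [kummerCoeff, ← mul_assoc (l.factorial : ℂ), factorial_mul_cbinom, e1, e2, e3, e4, e5, e6,
      Gamma_nat_eq_factorial, Gamma_nat_eq_factorial]
    have f1 : (q.factorial : ℂ) ≠ 0 := by exact_mod_cast q.factorial_ne_zero
    have f2 : ((2 * q).factorial : ℂ) ≠ 0 := by exact_mod_cast (2 * q).factorial_ne_zero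
    have f3 := sqrt_pi_ne_zero
    have hD' := eq_div_of_mul_eq f2 hD
    have hG' := eq_div_of_mul_eq f2 hG
    have h4 : (4 : ℂ) ^ q ≠ 0 := pow_ne_zero _ (by norm_num)
    have h1 : ((-1 : ℂ) ^ q) ≠ 0 := pow_ne_zero _ (by norm_num)
    have h11 : ((-1 : ℂ) ^ q) ^ 2 = 1 := by rw [← pow_mul, mul_comm, pow_mul]; simp
    rw [hD', hG', neg_pow (4 : ℂ)]
    generalize ((Real.sqrt Real.pi : ℝ) : ℂ) = S at *
    generalize (-1 : ℂ) ^ q = E at *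
    field_simp
    linear_combination ((2 * q + l).factorial : ℂ) * h11
  · by_cases hint : ∃ m : ℤ, 2 * μ = m
    · obtain ⟨m, hm⟩ := hint
      obtain ⟨k, hk⟩ := Int.even_or_odd' m
      have hμ : μ = k := by
        rcases hk with hk | hk
        · rw [hk] at hm; push_cast at hm; linear_combination hm / 2
        -- Half-integers round down, so an odd `2μ` would fall under the first branch of the
        -- definition.
        · exfalso
          apply h
          have hμ : μ = k + 1 / 2 := by rw [hk] at hm; push_cast at hm; linear_combination hm / 2
          have : nearestInt μ.re = k := by
            rw [← nearestInt_intCast_add_half k, hμ]; simp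
          rw [this, hμ]
      subst hμ
      rw [intCast_re, nearestInt_intCast] at hl'
      obtain ⟨a, ha⟩ : ∃ a : ℕ, k = -(a + l + 1 : ℤ) := ⟨(-k - l - 1).toNat, by omega⟩
      subst ha
      -- Both gamma functions in a denominator sit at poles, where `Gamma` is `0`, so quotient and
      -- Kummer coefficient vanish together.
      have e1 : ((l + 1 : ℕ) : ℂ) + 2 * ((-(a + l + 1 : ℤ) : ℤ) : ℂ) = -(2 * a + l + 1 : ℕ) := by
        push_cast; ring
      have e2 : ((-(a + l + 1 : ℤ) : ℤ) : ℂ) + l + 1 = -(a : ℕ) := by push_cast; ring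
      rw [kummerCoeff, e1, e2, Gamma_neg_nat_eq_zero, inv_Gamma_neg_natCast]
      simp
    · push_cast
      exact Gamma_div_Gamma_mul_two_cpow l (by simpa using hint)

theorem chi_eq_of_ne_zero (μ : ℂ) {z : ℂ} (hz : z ≠ 0) :
    chi μ z = (z / 2) ^ μ * (exp (I * z) *
      ∑ l ∈ Finset.range (-nearestInt μ.re).toNat, (-I * z / 2) ^ l * kummerCoeff μ l) := by
  rw [chi]
  split_ifs with h
  · rw [← Finset.Ico_succ_right_eq_Icc, Finset.sum_Ico_eq_sum_range, Finset.mul_sum,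
      Finset.mul_sum, Finset.mul_sum]
    refine Finset.sum_congr rfl fun l hl => ?_
    have hl' : l < (-nearestInt μ.re).toNat := by simpa using hl
    have hq := gammaQuotient_mul_two_cpow hl'
    have e1 : branchPow (-2 * I * z) ((1 + l : ℕ) + μ - 1) =
        I ^ (-μ) * (-I) ^ l * (2 ^ (μ + l) * (z ^ μ * z ^ l)) := by
      rw [show -2 * I * z = -I * (((2 : ℝ) : ℂ) * z) by push_cast; ring, branchPow_neg_I_mul,
        ofReal_mul_cpow zero_le_two, show ((1 + l : ℕ) + μ - 1) = μ + l by push_cast; ring,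
        cpow_add _ _ hz, cpow_natCast, neg_add, cpow_add _ _ I_ne_zero, cpow_neg I l, cpow_natCast,
        ← inv_pow, inv_I, ofReal_ofNat]
    have e3 : (2 : ℂ) ^ (2 * (μ + l)) = 2 ^ (μ + l) * (2 ^ μ * 2 ^ l) := by
      rw [two_mul, cpow_add _ _ two_ne_zero, cpow_add μ _ two_ne_zero, cpow_natCast]
    rw [add_comm l 1, e3] at hq
    have f1 : (l.factorial : ℂ) ≠ 0 := by exact_mod_cast l.factorial_ne_zero
    have f3 := sqrt_pi_ne_zero
    have f4 : I ^ μ ≠ 0 := by simp [cpow_eq_zero_iff]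
    rw [e1, div_two_cpow, cpow_neg, show ((1 + l : ℕ) : ℂ) = l + 1 by push_cast; ring,
      Gamma_nat_eq_factorial, show -I * z / 2 = -I * z * 2⁻¹ by ring, mul_pow, mul_pow, inv_pow]
    have g1 := two_cpow_ne_zero μ
    have g2 := two_cpow_ne_zero (μ + l)
    have g3 : (2 : ℂ) ^ l ≠ 0 := pow_ne_zero _ two_ne_zero
    generalize gammaQuotient (1 + l) μ = Q at *
    generalize kummerCoeff μ l = K at *
    generalize ((Real.sqrt Real.pi : ℝ) : ℂ) = S at *
    generalize (2 : ℂ) ^ (μ + l) = E at *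
    generalize (2 : ℂ) ^ μ = F at *
    generalize (2 : ℂ) ^ l = G at *
    generalize (-I) ^ l = J at *
    generalize I ^ μ = L at *
    field_simp
    linear_combination J * z ^ μ * hq
  · have : nearestInt μ.re ≥ 0 := by
      rw [nearestInt, ge_iff_le, ← Int.sub_one_lt_iff, Int.lt_ceil]
      push_cast
      linarith
    rw [show (-nearestInt μ.re).toNat = 0 by omega]
    simp

theorem chi_intCast (m : ℤ) (z : ℂ) : chi m z = 0 := by
  rw [chi]
  split_ifs with h
  · rw [Finset.sum_eq_zero, mul_zero]
    intro j hj
    rw [Finset.mem_Icc] at hj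
    obtain ⟨l, rfl⟩ : ∃ l, j = l + 1 := ⟨j - 1, by omega⟩
    have hq := gammaQuotient_mul_two_cpow (μ := m) (l := l) (by omega)
    have hl := hj.2
    rw [intCast_re, nearestInt_intCast] at hl
    obtain ⟨a, ha⟩ : ∃ a : ℕ, m = -(a + l + 1 : ℤ) := ⟨(-m - l - 1).toNat, by omega⟩
    have hk : kummerCoeff m l = 0 := by
      rw [kummerCoeff, show (m : ℂ) + l + 1 = -(a : ℕ) by rw [ha]; push_cast; ring,
        inv_Gamma_neg_natCast, mul_zero]
    rw [hk, mul_zero, mul_zero, mul_eq_zero, or_iff_left (two_cpow_ne_zero _)] at hq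
    rw [hq, zero_div, zero_mul]
  · rfl

/-! ### Analyticity of Bessel functions and the derivative recursion -/

/-- The entire function `y ↦ ∑ (-1)^k y^k / (k! Γ(μ + k + 1))` (Bessel–Clifford). -/
def clifford (μ y : ℂ) : ℂ :=
  ∑' k : ℕ, (-1) ^ k * y ^ k / ((k.factorial : ℂ) * Gamma (μ + k + 1))

theorem besselJ_eq (μ z : ℂ) : besselJ μ z = (z / 2) ^ μ * clifford μ ((z / 2) ^ 2) := by
  simp only [besselJ, clifford, pow_mul]

theorem norm_clifford_term (μ y : ℂ) (k : ℕ) :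
    ‖(-1) ^ k * y ^ k / ((k.factorial : ℂ) * Gamma (μ + k + 1))‖ =
      ‖y ^ k / ((k.factorial : ℂ) * Gamma (μ + k + 1))‖ := by
  simp

theorem summable_clifford (μ y : ℂ) : Summable fun k : ℕ =>
    (-1) ^ k * y ^ k / ((k.factorial : ℂ) * Gamma (μ + k + 1)) := by
  refine Summable.of_norm ?_
  simpa only [norm_clifford_term] using summable_norm_pow_div_factorial_mul_Gamma μ y

theorem clifford_term_succ (μ y : ℂ) (k : ℕ) :
    (k + 1) * ((-1) ^ (k + 1) * y ^ k / (((k + 1).factorial : ℂ) * Gamma (μ + (k + 1 : ℕ) + 1))) =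
      -((-1) ^ k * y ^ k / ((k.factorial : ℂ) * Gamma (μ + 1 + k + 1))) := by
  have h : (k + 1 : ℂ) ≠ 0 := by exact_mod_cast k.succ_ne_zero
  rw [Nat.factorial_succ]
  push_cast
  rw [show μ + (k + 1) + 1 = μ + 1 + k + 1 by ring, pow_succ, mul_assoc, mul_div_mul_comm,
    mul_comm (k + 1 : ℂ)]
  field_simp

theorem hasDerivAt_clifford (μ y : ℂ) : HasDerivAt (clifford μ) (-clifford (μ + 1) y) y := by
  set R : ℝ := ‖y‖ + 1
  set F : ℕ → ℂ → ℂ := fun k y => (-1) ^ k * y ^ k / ((k.factorial : ℂ) * Gamma (μ + k + 1))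
  have hu : Summable fun k : ℕ => ‖(R : ℂ) ^ k / ((k.factorial : ℂ) * Gamma (μ + k + 1))‖ :=
    summable_norm_pow_div_factorial_mul_Gamma μ R
  have hF : ∀ k : ℕ, DifferentiableOn ℂ (F k) (Metric.ball 0 R) := fun k => by
    simp only [F]; fun_prop
  have hle : ∀ (k : ℕ) (w : ℂ), w ∈ Metric.ball 0 R →
      ‖F k w‖ ≤ ‖(R : ℂ) ^ k / ((k.factorial : ℂ) * Gamma (μ + k + 1))‖ := by
    intro k w hw
    have hw' : ‖w‖ ≤ ‖(R : ℂ)‖ := by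
      rw [norm_real, Real.norm_of_nonneg (by positivity)]
      exact (mem_ball_zero_iff.1 hw).le
    simp only [F]
    rw [norm_clifford_term, norm_div, norm_div, norm_pow, norm_pow]
    gcongr
  have hy : y ∈ Metric.ball (0 : ℂ) R := by simp [R]
  have hd := ((differentiableOn_tsum_of_summable_norm hu hF Metric.isOpen_ball hle).differentiableAt
    (Metric.isOpen_ball.mem_nhds hy)).hasDerivAt
  have hsum := (hasSum_deriv_of_summable_norm hu hF Metric.isOpen_ball hle hy)
  have hder : ∀ k, deriv (F k) y =
      (-1) ^ k * (k * y ^ (k - 1)) / ((k.factorial : ℂ) * Gamma (μ + k + 1)) := by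
    intro k
    simp [F, deriv_div_const]
  have heq : deriv (fun w => ∑' k, F k w) y = -clifford (μ + 1) y := by
    rw [← hsum.tsum_eq, hsum.summable.tsum_eq_zero_add, clifford, ← tsum_neg]
    simp only [hder]
    rw [Nat.cast_zero, zero_mul, mul_zero, zero_div, zero_add]
    refine tsum_congr fun k => ?_
    rw [← clifford_term_succ, Nat.add_sub_cancel]
    push_cast
    ring
  rw [heq] at hd
  exact hd

/-- Write `1/Γ(μ+k) = (μ+k)/Γ(μ+k+1)`: the summand `μ` gives the first term, and the factor `k`
shifts the series to order `μ + 1`. -/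
theorem clifford_sub_one (μ y : ℂ) :
    clifford (μ - 1) y = μ * clifford μ y - y * clifford (μ + 1) y := by
  have h1 : clifford (μ - 1) y = ∑' k : ℕ,
      (μ * ((-1) ^ k * y ^ k / ((k.factorial : ℂ) * Gamma (μ + k + 1))) +
        k * ((-1) ^ k * y ^ k / ((k.factorial : ℂ) * Gamma (μ + k + 1)))) := by
    refine tsum_congr fun k => ?_
    rw [show μ - 1 + k + 1 = μ + k by ring, div_eq_mul_inv, mul_inv, inv_Gamma_eq_mul (μ + k),
      div_eq_mul_inv, mul_inv]
    ring
  have hk : ∀ k : ℕ, ((k + 1 : ℕ) : ℂ) * ((-1) ^ (k + 1) * y ^ (k + 1) /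
      (((k + 1).factorial : ℂ) * Gamma (μ + (k + 1 : ℕ) + 1))) =
      -y * ((-1) ^ k * y ^ k / ((k.factorial : ℂ) * Gamma (μ + 1 + k + 1))) := by
    intro k
    have := clifford_term_succ μ y k
    rw [pow_succ y]
    push_cast at this ⊢
    linear_combination y * this
  have hs : Summable fun k : ℕ =>
      (k : ℂ) * ((-1) ^ k * y ^ k / ((k.factorial : ℂ) * Gamma (μ + k + 1))) := by
    rw [← summable_nat_add_iff 1]
    simp only [hk]
    exact (summable_clifford (μ + 1) y).mul_left _
  rw [h1, ((summable_clifford μ y).mul_left μ).tsum_add hs, tsum_mul_left, hs.tsum_eq_zero_add]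
  simp only [hk, tsum_mul_left]
  simp only [clifford]
  push_cast
  ring

theorem hasDerivAt_besselJ (μ : ℂ) {z : ℂ} (hz : z ∈ slitPlane) :
    HasDerivAt (besselJ μ) ((besselJ (μ - 1) z - besselJ (μ + 1) z) / 2) z := by
  have hz2 : z / 2 ∈ slitPlane := by
    rw [mem_slitPlane_iff] at hz ⊢
    simpa using hz
  have h0 : z / 2 ≠ 0 := slitPlane_ne_zero hz2
  have h1 : HasDerivAt (fun w : ℂ => w / 2) (1 / 2) z := (hasDerivAt_id z).div_const 2
  have h2 : HasDerivAt (fun w : ℂ => (w / 2) ^ μ) (μ * (z / 2) ^ (μ - 1) * (1 / 2)) z :=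
    h1.cpow_const hz2
  have h3 := (hasDerivAt_clifford μ ((z / 2) ^ 2)).comp z (h1.pow 2)
  have h4 := h2.mul h3
  have hfun : besselJ μ = fun w => (w / 2) ^ μ * clifford μ ((w / 2) ^ 2) := funext (besselJ_eq μ)
  rw [hfun]
  refine h4.congr_deriv ?_
  have e1 : (z / 2) ^ μ = (z / 2) ^ (μ - 1) * (z / 2) := by
    rw [cpow_sub _ _ h0, cpow_one, div_mul_cancel₀ _ h0]
  have e2 : (z / 2) ^ (μ + 1) = (z / 2) ^ (μ - 1) * (z / 2) ^ 2 := by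
    rw [cpow_add _ _ h0, cpow_one, e1]; ring
  rw [besselJ_eq, besselJ_eq, e2, clifford_sub_one, e1]
  simp only [Function.comp_apply, Pi.pow_apply]
  push_cast
  ring

theorem besselJ_natCast (n : ℕ) (z : ℂ) :
    besselJ n z = (z / 2) ^ n * clifford n ((z / 2) ^ 2) := by
  rw [besselJ_eq, cpow_natCast]

/-- `1/Γ(-n+k+1)` vanishes for `k < n`, and the surviving tail is the series of order `n`. -/
theorem besselJ_neg_natCast (n : ℕ) (z : ℂ) : besselJ (-n) z = (-1) ^ n * besselJ n z := by
  rcases Nat.eq_zero_or_pos n with rfl | hn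
  · simp
  rcases eq_or_ne z 0 with rfl | hz
  · have : (n : ℂ) ≠ 0 := by exact_mod_cast hn.ne'
    simp [besselJ_eq, zero_cpow this, zero_cpow (neg_ne_zero.2 this)]
  have hz2 : z / 2 ≠ 0 := div_ne_zero hz two_ne_zero
  have hc : clifford (-n) ((z / 2) ^ 2) = (-1) ^ n * (z / 2) ^ (2 * n) *
      clifford n ((z / 2) ^ 2) := by
    rw [clifford, ← (summable_clifford (-n) _).sum_add_tsum_nat_add n, Finset.sum_eq_zero, zero_add,
      clifford, ← tsum_mul_left]
    · refine tsum_congr fun k => ?_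
      rw [pow_mul, show (-n : ℂ) + (k + n : ℕ) + 1 = k + 1 by push_cast; ring, Gamma_nat_eq_factorial,
        show (n : ℂ) + k + 1 = (k + n : ℕ) + 1 by push_cast; ring, Gamma_nat_eq_factorial]
      ring
    · intro k hk
      have hk' : k < n := by simpa using hk
      obtain ⟨a, rfl⟩ : ∃ a, n = a + k + 1 := ⟨n - k - 1, by omega⟩
      rw [show (-(a + k + 1 : ℕ) : ℂ) + k + 1 = -(a : ℕ) by push_cast; ring,
        Gamma_neg_nat_eq_zero]
      simp
  rw [besselJ_natCast, besselJ_eq, hc, cpow_neg, cpow_natCast, mul_comm 2 n, pow_mul]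
  field_simp

theorem differentiable_besselJ_intCast (m : ℤ) : Differentiable ℂ (besselJ m) := by
  have hnat : ∀ n : ℕ, Differentiable ℂ (besselJ n) := fun n z => by
    have h1 : HasDerivAt (fun w : ℂ => w / 2) (1 / 2) z := (hasDerivAt_id z).div_const 2
    rw [funext (besselJ_natCast n)]
    exact ((h1.pow n).mul ((hasDerivAt_clifford n ((z / 2) ^ 2)).comp z
      (h1.pow 2))).differentiableAt
  obtain ⟨n, rfl | rfl⟩ := m.eq_nat_or_neg
  · simpa using hnat n
  · rw [Int.cast_neg, Int.cast_natCast, funext (besselJ_neg_natCast n)]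
    exact (hnat n).const_mul _

theorem dense_slitPlane : Dense slitPlane := by
  intro z
  -- Moving along `1 + I` makes the imaginary part nonzero for all small positive parameters.
  refine mem_closure_of_tendsto (f := fun x : ℝ => z + x * (1 + I)) (b := nhdsWithin 0 (Set.Ioi 0))
    ?_ ?_
  · have : Continuous fun x : ℝ => z + x * (1 + I) := by fun_prop
    simpa using (this.tendsto 0).mono_left nhdsWithin_le_nhds
  · have h : ∀ᶠ x : ℝ in nhdsWithin 0 (Set.Ioi 0), x ≠ -z.im := by
      by_cases hz : z.im = 0
      · filter_upwards [self_mem_nhdsWithin] with x hx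
        rw [hz, neg_zero]
        exact ne_of_gt hx
      · exact (eventually_ne_nhds (by simpa using Ne.symm (neg_ne_zero.2 hz))).filter_mono
          nhdsWithin_le_nhds
    filter_upwards [h] with x hx
    rw [mem_slitPlane_iff]
    right
    simp only [add_im, mul_im, ofReal_re, I_im, one_im, ofReal_im]
    intro h
    apply hx
    simp at h
    linarith

/-- For integer order both sides are continuous on the plane, so the identity extends from the dense
slit plane across the cut and to `0`. -/
theorem hasDerivAt_besselJ_intCast (m : ℤ) (z : ℂ) :
    HasDerivAt (besselJ m) ((besselJ (m - 1) z - besselJ (m + 1) z) / 2) z := by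
  have hd := differentiable_besselJ_intCast
  have h1 := hd (m - 1)
  have h2 := hd (m + 1)
  push_cast at h1 h2
  have heq : deriv (besselJ m) = fun z => (besselJ (m - 1) z - besselJ (m + 1) z) / 2 := by
    refine Continuous.ext_on dense_slitPlane ?_ ?_ fun z hz => (hasDerivAt_besselJ m hz).deriv
    · exact ((hd m).contDiff (n := 1)).continuous_deriv le_rfl
    · exact ((h1.sub h2).div_const 2).continuous
  rw [← congrFun heq z]
  exact (hd m z).hasDerivAt

/-! ### Regular points and higher derivatives -/

/-- Pairs `(μ, z)` at which `J_μ` is given by an analytic branch. -/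
def IsRegular (μ z : ℂ) : Prop := z ∈ slitPlane ∨ ∃ m : ℤ, μ = m

theorem IsRegular.add_intCast {μ z : ℂ} (h : IsRegular μ z) (k : ℤ) : IsRegular (μ + k) z := by
  rcases h with h | ⟨m, rfl⟩
  · exact Or.inl h
  · exact Or.inr ⟨m + k, by push_cast; rfl⟩

theorem IsRegular.eventually {μ z : ℂ} (h : IsRegular μ z) : ∀ᶠ w in nhds z, IsRegular μ w := by
  rcases h with h | h
  · filter_upwards [isOpen_slitPlane.mem_nhds h] with w hw using Or.inl hw
  · exact Filter.Eventually.of_forall fun _ => Or.inr h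

theorem IsRegular.hasDerivAt_besselJ {μ z : ℂ} (h : IsRegular μ z) :
    HasDerivAt (besselJ μ) ((besselJ (μ - 1) z - besselJ (μ + 1) z) / 2) z := by
  rcases h with h | ⟨m, rfl⟩
  · exact BesselMixed.hasDerivAt_besselJ μ h
  · exact hasDerivAt_besselJ_intCast m z

theorem IsRegular.analyticAt_besselJ {μ z : ℂ} (h : IsRegular μ z) :
    AnalyticAt ℂ (besselJ μ) z := by
  rw [analyticAt_iff_eventually_differentiableAt]
  filter_upwards [h.eventually] with w hw using hw.hasDerivAt_besselJ.differentiableAt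

theorem iteratedDeriv_besselJ (n : ℕ) {μ z : ℂ} (h : IsRegular μ z) :
    iteratedDeriv n (besselJ μ) z = 1 / 2 ^ n * ∑ j ∈ Finset.range (n + 1),
      (-1) ^ j * (n.choose j : ℂ) * besselJ (μ - n + 2 * j) z := by
  have key := eq_sum_choose_of_recursion (S := {μ | IsRegular μ z}) (σ := -1) (u := -1) (v := 1)
    (G := fun n μ => 2 ^ n * iteratedDeriv n (besselJ μ) z) ?_ ?_ ?_ n μ h
  · simp only [pow_zero, one_mul, iteratedDeriv_zero] at key
    rw [one_div, eq_inv_mul_iff_mul_eq₀ (pow_ne_zero _ two_ne_zero), key]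
    refine Finset.sum_congr rfl fun j _ => ?_
    congr 2
    ring
  · intro μ hμ
    simpa using IsRegular.add_intCast hμ (-1)
  · intro μ hμ
    simpa using IsRegular.add_intCast hμ 1
  · intro n μ hμ
    have h1 : IsRegular (μ - 1) z := by simpa [sub_eq_add_neg] using IsRegular.add_intCast hμ (-1)
    have h2 : IsRegular (μ + 1) z := by simpa using IsRegular.add_intCast hμ 1
    have hev : deriv (besselJ μ) =ᶠ[nhds z]
        (2⁻¹ : ℂ) • (besselJ (μ - 1) - besselJ (μ + 1)) := by
      filter_upwards [IsRegular.eventually hμ] with w hw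
      rw [hw.hasDerivAt_besselJ.deriv, Pi.smul_apply, Pi.sub_apply, smul_eq_mul]
      ring
    have c1 := h1.analyticAt_besselJ.contDiffAt (n := n)
    have c2 := h2.analyticAt_besselJ.contDiffAt (n := n)
    rw [iteratedDeriv_succ', hev.iteratedDeriv_eq, iteratedDeriv_const_smul_field,
      iteratedDeriv_sub c1 c2]
    simp only [smul_eq_mul]
    rw [← sub_eq_add_neg]
    ring

open intervalIntegral MeasureTheory

/-! ### Cauchy's cosine integral -/

/-- `2 cos (θ / 2)`, the modulus of `1 + e^{iθ}` for `|θ| ≤ π`. -/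
def halfBase (θ : ℝ) : ℝ := 2 * Real.cos (θ / 2)

theorem halfBase_nonneg {θ : ℝ} (h1 : -Real.pi ≤ θ) (h2 : θ ≤ Real.pi) : 0 ≤ halfBase θ :=
  mul_nonneg zero_le_two (Real.cos_nonneg_of_neg_pi_div_two_le_of_le (by linarith) (by linarith))

theorem halfBase_pos {θ : ℝ} (h1 : -Real.pi < θ) (h2 : θ < Real.pi) : 0 < halfBase θ :=
  mul_pos zero_lt_two (Real.cos_pos_of_mem_Ioo ⟨by linarith, by linarith⟩)

theorem continuous_halfBase : Continuous halfBase := by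
  unfold halfBase; fun_prop

theorem halfBase_pi : halfBase Real.pi = 0 := by simp [halfBase]

theorem continuous_halfBase_cpow {α : ℂ} (hα : 0 < α.re) :
    Continuous fun θ : ℝ => (halfBase θ : ℂ) ^ α :=
  (continuous_ofReal_cpow_const hα).comp continuous_halfBase

/-- The only singularity is at `θ = π`. With `x = π - θ` the base is `2 sin(x/2) = x sinc(x/2)`,
where the `sinc` factor is positive on `[0, π]`, so `x^α` decides. -/
theorem intervalIntegrable_halfBase_cpow {α : ℂ} (hα : -1 < α.re) :
    IntervalIntegrable (fun θ : ℝ => (halfBase θ : ℂ) ^ α) volume 0 Real.pi := by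
  have hpi := Real.pi_pos
  have hpos : ∀ x ∈ Set.uIcc 0 Real.pi, 0 < Real.sinc (x / 2) := by
    intro x hx
    rw [Set.uIcc_of_le hpi.le] at hx
    rcases eq_or_ne x 0 with rfl | h0
    · simp
    · have hx0 : 0 < x := lt_of_le_of_ne hx.1 h0.symm
      rw [Real.sinc_of_ne_zero (by positivity)]
      exact div_pos (Real.sin_pos_of_pos_of_lt_pi (by linarith) (by linarith [hx.2])) (by linarith)
  have h1 : IntervalIntegrable
      (fun x : ℝ => (x : ℂ) ^ α * ((Real.sinc (x / 2) : ℝ) : ℂ) ^ α) volume 0 Real.pi := by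
    refine (intervalIntegrable_cpow' hα).mul_continuousOn ?_
    refine ContinuousOn.cpow_const ?_ fun x hx => ofReal_mem_slitPlane.2 (hpos x hx)
    exact (continuous_ofReal.comp
      (Real.continuous_sinc.comp (continuous_id.div_const 2))).continuousOn
  have h2 : IntervalIntegrable (fun x : ℝ => (halfBase (Real.pi - x) : ℂ) ^ α) volume
      0 Real.pi := by
    refine h1.congr fun x hx => ?_
    rw [Set.uIoc_of_le hpi.le] at hx
    have hx' : x ∈ Set.uIcc 0 Real.pi := by
      rw [Set.uIcc_of_le hpi.le]; exact ⟨hx.1.le, hx.2⟩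
    rw [← mul_cpow_ofReal_nonneg hx.1.le (hpos x hx').le, ← ofReal_mul, halfBase,
      show (Real.pi - x) / 2 = Real.pi / 2 - x / 2 by ring, Real.cos_pi_div_two_sub,
      Real.sinc_of_ne_zero (by have := hx.1; positivity)]
    congr 2
    have := hx.1.ne'
    field_simp
  have h3 := h2.comp_sub_left Real.pi
  simpa using h3.symm

/-- `∫_0^π (2 cos (θ / 2))^α cos (μ θ) dθ`. -/
def cosIntegral (α μ : ℂ) : ℂ :=
  ∫ θ in (0 : ℝ)..Real.pi, (halfBase θ : ℂ) ^ α * cos (μ * θ)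

theorem continuous_cos_mul (μ : ℂ) : Continuous fun θ : ℝ => cos (μ * θ) := by fun_prop

theorem intervalIntegrable_halfBase_cpow_mul {α : ℂ} (hα : -1 < α.re) (μ : ℂ) :
    IntervalIntegrable (fun θ : ℝ => (halfBase θ : ℂ) ^ α * cos (μ * θ)) volume 0 Real.pi :=
  (intervalIntegrable_halfBase_cpow hα).mul_continuousOn (continuous_cos_mul μ).continuousOn

theorem add_one_ne_zero_of_re {α : ℂ} (hα : -1 < α.re) (m : ℕ) : α + 1 + m ≠ 0 := by
  intro h
  have := congrArg re h
  simp at this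
  have hm : (0 : ℝ) ≤ m := m.cast_nonneg
  linarith

/-- The combined integrand is the derivative of `(2 cos(θ/2))^{α+1} sin((μ+1/2)θ)`, which vanishes
at both endpoints. -/
theorem cosIntegral_recursion {α : ℂ} (hα : -1 < α.re) (μ : ℂ) :
    (μ - α / 2) * cosIntegral α μ + (μ + 1 + α / 2) * cosIntegral α (μ + 1) = 0 := by
  have hpi := Real.pi_pos
  have hα1 : 0 < (α + 1).re := by simp; linarith
  have hcont : ContinuousOn (fun θ : ℝ => (halfBase θ : ℂ) ^ (α + 1) * sin ((μ + 1 / 2) * θ))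
      (Set.Icc 0 Real.pi) := by
    have h2 : Continuous fun θ : ℝ => sin ((μ + 1 / 2) * θ) := by fun_prop
    exact ((continuous_halfBase_cpow hα1).mul h2).continuousOn
  have hi1 := (intervalIntegrable_halfBase_cpow_mul hα μ).const_mul (μ - α / 2)
  have hi2 := (intervalIntegrable_halfBase_cpow_mul hα (μ + 1)).const_mul (μ + 1 + α / 2)
  have hderiv : ∀ θ ∈ Set.Ioo 0 Real.pi,
      HasDerivAt (fun θ : ℝ => (halfBase θ : ℂ) ^ (α + 1) * sin ((μ + 1 / 2) * θ))
        ((μ - α / 2) * ((halfBase θ : ℂ) ^ α * cos (μ * θ)) +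
          (μ + 1 + α / 2) * ((halfBase θ : ℂ) ^ α * cos ((μ + 1) * θ))) θ := by
    intro θ hθ
    have hs : 0 < halfBase θ := halfBase_pos (by linarith [hθ.1]) hθ.2
    have hcast : ∀ t : ℝ, (halfBase t : ℂ) = 2 * cos ((t : ℂ) / 2) := fun t => by
      simp [halfBase]
    have hslit : 2 * cos ((θ : ℂ) / 2) ∈ slitPlane := by
      rw [← hcast]; exact ofReal_mem_slitPlane.2 hs
    have hne : 2 * cos ((θ : ℂ) / 2) ≠ 0 := slitPlane_ne_zero hslit
    simp only [hcast]
    have d1 : HasDerivAt (fun w : ℂ => 2 * cos (w / 2)) (2 * (-sin ((θ : ℂ) / 2) * (1 / 2))) θ :=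
      (((hasDerivAt_id (θ : ℂ)).div_const 2).ccos).const_mul 2
    have d2 : HasDerivAt (fun w : ℂ => (2 * cos (w / 2)) ^ (α + 1)) _ θ :=
      d1.cpow_const hslit
    have d3 : HasDerivAt (fun w : ℂ => sin ((μ + 1 / 2) * w))
        (cos ((μ + 1 / 2) * θ) * ((μ + 1 / 2) * 1)) θ :=
      ((hasDerivAt_id (θ : ℂ)).const_mul (μ + 1 / 2)).csin
    refine ((d2.mul d3).comp_ofReal).congr_deriv ?_
    rw [add_sub_cancel_right, cpow_add _ _ hne, cpow_one,
      show μ * (θ : ℂ) = (μ + 1 / 2) * θ - θ / 2 by ring,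
      show (μ + 1) * (θ : ℂ) = (μ + 1 / 2) * θ + θ / 2 by ring, cos_sub, cos_add]
    ring
  have hftc := integral_eq_sub_of_hasDerivAt_of_le hpi.le hcont hderiv (hi1.add hi2)
  rw [integral_add hi1 hi2, intervalIntegral.integral_const_mul, intervalIntegral.integral_const_mul, halfBase_pi] at hftc
  have hne : α + 1 ≠ 0 := by simpa using add_one_ne_zero_of_re hα 0
  simpa [zero_cpow hne, cosIntegral] using hftc

theorem one_add_exp_cpow {θ : ℝ} (h1 : -Real.pi ≤ θ) (h2 : θ ≤ Real.pi) (α : ℂ) :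
    (1 + exp (θ * I)) ^ α = (halfBase θ : ℂ) ^ α * exp (α * θ / 2 * I) := by
  have hpi := Real.pi_pos
  have hb : 1 + exp (θ * I) = (halfBase θ : ℂ) * exp ((θ / 2 : ℝ) * I) := by
    have : (halfBase θ : ℂ) = exp ((θ / 2 : ℝ) * I) + exp (-(θ / 2 : ℝ) * I) := by
      rw [halfBase, ofReal_mul, ofReal_cos, ofReal_ofNat, two_cos]
    rw [this, add_mul, ← exp_add, ← exp_add]
    rw [neg_mul, neg_add_cancel, exp_zero, add_comm]
    congr 2
    push_cast
    ring
  rcases (halfBase_nonneg h1 h2).eq_or_lt with h0 | hpos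
  · rw [hb, ← h0, ofReal_zero, zero_mul]
    rcases eq_or_ne α 0 with rfl | hα
    · simp
    · rw [zero_cpow hα, zero_mul]
  · rw [hb, ofReal_mul_cpow hpos.le, cpow_def_of_ne_zero (exp_ne_zero _), log_exp]
    · congr 2
      push_cast
      ring
    · simp; linarith
    · simp; linarith

/-- Mean value property of `(1+u)^α` on the unit disc: the circle average is the value `1` at the
centre. On the circle `1 + e^{iθ} = 2 cos(θ/2) e^{iθ/2}`, and the two half circles combine into a
cosine. `Re α > 0` gives continuity at `u = -1`. -/
theorem cosIntegral_half_of_pos {α : ℂ} (hα : 0 < α.re) :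
    cosIntegral α (α / 2) = Real.pi := by
  have hpi := Real.pi_pos
  have hre : ∀ u ∈ Metric.closedBall (0 : ℂ) 1, 0 ≤ (1 + u).re := by
    intro u hu
    have h1 := abs_re_le_norm u
    have h2 : ‖u‖ ≤ 1 := by simpa using hu
    have := neg_abs_le u.re
    simp only [add_re, one_re]
    linarith
  have hca : ∀ u ∈ Metric.closedBall (0 : ℂ) 1, ContinuousAt (fun u : ℂ => (1 + u) ^ α) u := by
    intro u hu
    exact ContinuousAt.comp (f := fun u : ℂ => 1 + u)
      (continuousAt_cpow_const_of_re_pos (Or.inl (hre u hu)) hα) (by fun_prop)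
  have hd : DiffContOnCl ℂ (fun u : ℂ => (1 + u) ^ α) (Metric.ball 0 |1|) := by
    rw [abs_one]
    constructor
    · intro u hu
      have h1 := abs_re_le_norm u
      have h2 : ‖u‖ < 1 := by simpa using hu
      have h3 := neg_abs_le u.re
      have : 1 + u ∈ slitPlane := by
        rw [mem_slitPlane_iff]; left; simp only [add_re, one_re]; linarith
      exact ((((hasDerivAt_id u).const_add 1).cpow_const
        this).differentiableAt).differentiableWithinAt
    · exact fun u hu => (hca u (Metric.closure_ball_subset_closedBall hu)).continuousWithinAt
  have hav := hd.circleAverage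
  rw [Real.circleAverage_def] at hav
  set g : ℝ → ℂ := fun θ => (1 + exp (θ * I)) ^ α with hg
  have hgc : Continuous g := by
    rw [continuous_iff_continuousAt]
    intro θ
    refine ContinuousAt.comp (f := fun θ : ℝ => exp (θ * I)) (g := fun u => (1 + u) ^ α)
      (hca _ ?_) (by fun_prop)
    simp [norm_exp_ofReal_mul_I]
  have hint : ∫ θ in (0 : ℝ)..2 * Real.pi, g θ = 2 * Real.pi := by
    have h2pi : (2 * Real.pi : ℂ) ≠ 0 := by exact_mod_cast (by positivity : 2 * Real.pi ≠ 0)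
    simp only [circleMap, zero_add, ofReal_one, one_mul, add_zero, one_cpow, real_smul] at hav
    push_cast at hav
    rwa [inv_mul_eq_one₀ h2pi, eq_comm] at hav
  have hg1 : ∫ θ in (Real.pi)..(2 * Real.pi), g θ =
      ∫ θ in (0 : ℝ)..Real.pi, g (2 * Real.pi - θ) := by
    rw [integral_comp_sub_left]
    congr 1 <;> ring
  have hsplit := integral_add_adjacent_intervals (hgc.intervalIntegrable (μ := volume) 0 Real.pi)
    (hgc.intervalIntegrable Real.pi (2 * Real.pi))
  have hgc2 : Continuous fun θ => g (2 * Real.pi - θ) := by fun_prop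
  rw [hg1, hint, ← integral_add (hgc.intervalIntegrable _ _) (hgc2.intervalIntegrable _ _)]
    at hsplit
  have hcongr : ∫ θ in (0 : ℝ)..Real.pi, (g θ + g (2 * Real.pi - θ)) =
      ∫ θ in (0 : ℝ)..Real.pi, 2 * ((halfBase θ : ℂ) ^ α * cos (α / 2 * θ)) := by
    refine integral_congr fun θ hθ => ?_
    rw [Set.uIcc_of_le hpi.le] at hθ
    have e1 : exp ((2 * Real.pi - θ : ℝ) * I) = exp ((-θ : ℝ) * I) := by
      push_cast
      rw [sub_mul, exp_sub, exp_two_pi_mul_I, neg_mul, exp_neg, one_div]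
    have e2 : halfBase (-θ) = halfBase θ := by simp [halfBase, neg_div]
    simp only [hg]
    rw [e1, one_add_exp_cpow (by linarith [hθ.1]) hθ.2,
      one_add_exp_cpow (by linarith [hθ.2]) (by linarith [hθ.1]), e2, mul_left_comm, two_cos]
    push_cast
    rw [← mul_add]
    ring_nf
  rw [hcongr, intervalIntegral.integral_const_mul] at hsplit
  exact mul_left_cancel₀ two_ne_zero hsplit

/-- At `μ = α/2` the first coefficient of the recursion vanishes, which forces the next value to be
zero; the zeros then propagate upwards. -/
theorem cosIntegral_half_add {α : ℂ} (hα : -1 < α.re) (m : ℕ) :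
    cosIntegral α (α / 2 + 1 + m) = 0 := by
  induction m with
  | zero =>
    have h := cosIntegral_recursion hα (α / 2)
    have h1 := add_one_ne_zero_of_re hα 0
    rw [sub_self, zero_mul, zero_add, mul_eq_zero] at h
    rcases h with h | h
    · exact absurd (by push_cast; linear_combination h) h1
    · simpa using h
  | succ m ih =>
    have h := cosIntegral_recursion hα (α / 2 + 1 + m)
    have h1 := add_one_ne_zero_of_re hα (m + 1)
    rw [ih, mul_zero, zero_add, mul_eq_zero] at h
    rcases h with h | h
    · exact absurd (by push_cast; linear_combination h) h1
    · rw [← h]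
      push_cast
      ring_nf

/-- Extends the value to `Re α > -1`: by the sum-to-product formula the integral with exponent `α +
1` is the sum of two with exponent `α`, one of which is zero. -/
theorem cosIntegral_half {α : ℂ} (hα : -1 < α.re) : cosIntegral α (α / 2) = Real.pi := by
  have hα1 : 0 < (α + 1).re := by simp; linarith
  have hne : α + 1 ≠ 0 := by simpa using add_one_ne_zero_of_re hα 0
  have h0 : cosIntegral α (α / 2 + 1) = 0 := by simpa using cosIntegral_half_add hα 0
  rw [← cosIntegral_half_of_pos hα1]
  have key : cosIntegral (α + 1) ((α + 1) / 2) =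
      cosIntegral α (α / 2) + cosIntegral α (α / 2 + 1) := by
    rw [cosIntegral, cosIntegral, cosIntegral,
      ← integral_add (intervalIntegrable_halfBase_cpow_mul hα _)
        (intervalIntegrable_halfBase_cpow_mul hα _)]
    refine integral_congr fun θ _ => ?_
    have hc : cos (α / 2 * θ) + cos ((α / 2 + 1) * θ) =
        (halfBase θ : ℂ) * cos ((α + 1) / 2 * θ) := by
      rw [halfBase, ofReal_mul, ofReal_cos, ofReal_ofNat,
        show α / 2 * (θ : ℂ) = (α + 1) / 2 * θ - (θ / 2 : ℝ) by push_cast; ring,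
        show (α / 2 + 1) * (θ : ℂ) = (α + 1) / 2 * θ + (θ / 2 : ℝ) by push_cast; ring,
        cos_sub, cos_add]
      ring
    rw [← mul_add, hc, ← mul_assoc]
    congr 1
    rcases eq_or_ne (halfBase θ : ℂ) 0 with hs | hs
    · rw [hs, zero_cpow hne, mul_zero]
    · rw [cpow_add _ _ hs, cpow_one]
  rw [key, h0, add_zero]

/-- Going down from `α/2`, the recursion becomes `(l+1) c_{l+1} = (α-l) c_l`, that of the binomial
coefficients. -/
theorem cosIntegral_half_sub {α : ℂ} (hα : -1 < α.re) (l : ℕ) :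
    cosIntegral α (α / 2 - l) = Real.pi * cbinom α l := by
  induction l with
  | zero => simp [cosIntegral_half hα, cbinom_zero]
  | succ l ih =>
    have h := cosIntegral_recursion hα (α / 2 - (l + 1))
    rw [show α / 2 - (l + 1) + 1 = α / 2 - l by ring, ih] at h
    have h2 := succ_mul_cbinom_succ α l
    have h3 : (l + 1 : ℂ) ≠ 0 := by exact_mod_cast l.succ_ne_zero
    apply mul_left_cancel₀ h3
    push_cast
    linear_combination Real.pi * h2.symm - h

/-! ### The same integrals in terms of `1 + cos θ` -/

/-- `1 + cos θ = (2 cos(θ/2))² / 2`. -/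
theorem one_add_cos_cpow {θ : ℝ} (h1 : 0 ≤ θ) (h2 : θ ≤ Real.pi) (a : ℂ) :
    ((1 + Real.cos θ : ℝ) : ℂ) ^ a = 2 ^ (-a) * (halfBase θ : ℂ) ^ (2 * a) := by
  have hs := halfBase_nonneg (by linarith [Real.pi_pos]) h2
  have ht : halfBase θ * halfBase θ = 2 * (1 + Real.cos θ) := by
    have := Real.cos_sq (θ / 2)
    rw [mul_div_cancel₀ θ two_ne_zero] at this
    rw [halfBase]
    linear_combination 4 * this
  have h3 : (halfBase θ : ℂ) ^ (2 * a) = 2 ^ a * ((1 + Real.cos θ : ℝ) : ℂ) ^ a := by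
    have := ofReal_mul_cpow zero_le_two ((1 + Real.cos θ : ℝ) : ℂ) a
    rw [ofReal_ofNat] at this
    rw [← this, show (2 : ℂ) = (2 : ℝ) by norm_num, ← ofReal_mul, ← ht, ofReal_mul, mul_cpow_ofReal_nonneg hs hs]
    rcases hs.eq_or_lt with h0 | hpos
    · rw [← h0]
      rcases eq_or_ne a 0 with rfl | ha
      · simp
      · simp [zero_cpow ha, ha]
    · rw [ofReal_ofNat, two_mul, cpow_add _ _ (ofReal_ne_zero.2 hpos.ne')]
  rw [h3, cpow_neg, inv_mul_cancel_left₀ (two_cpow_ne_zero a)]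

theorem intervalIntegrable_one_add_cos_cpow {a : ℂ} (ha : -(1 / 2) < a.re) :
    IntervalIntegrable (fun θ : ℝ => ((1 + Real.cos θ : ℝ) : ℂ) ^ a) volume 0 Real.pi := by
  have h : -1 < (2 * a).re := by simp; linarith
  refine ((intervalIntegrable_halfBase_cpow h).const_mul (2 ^ (-a))).congr fun θ hθ => ?_
  rw [Set.uIoc_of_le Real.pi_pos.le] at hθ
  exact (one_add_cos_cpow hθ.1.le hθ.2 a).symm

theorem integral_one_add_cos_cpow_mul_cos (a μ : ℂ) :
    ∫ θ in (0 : ℝ)..Real.pi, ((1 + Real.cos θ : ℝ) : ℂ) ^ a * cos (μ * θ) =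
      2 ^ (-a) * cosIntegral (2 * a) μ := by
  rw [cosIntegral, ← intervalIntegral.integral_const_mul]
  refine integral_congr fun θ hθ => ?_
  rw [Set.uIcc_of_le Real.pi_pos.le] at hθ
  rw [one_add_cos_cpow hθ.1 hθ.2, mul_assoc]

theorem integral_one_add_cos_cpow_add_natCast {μ : ℂ} (l : ℕ) (h : -(1 / 2) < (μ + l).re) :
    ∫ θ in (0 : ℝ)..Real.pi, ((1 + Real.cos θ : ℝ) : ℂ) ^ (μ + l) * cos (μ * θ) =
      Real.pi * 2 ^ (-(μ + l)) * cbinom (2 * (μ + l)) l := by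
  have h' : -1 < (2 * (μ + l)).re := by
    rw [mul_re]; simp at h ⊢; linarith
  have := cosIntegral_half_sub h' l
  rw [mul_div_cancel_left₀ _ two_ne_zero, add_sub_cancel_right] at this
  rw [integral_one_add_cos_cpow_mul_cos, this]
  ring

theorem integral_one_add_cos_cpow_eq_zero {a : ℂ} (ha : -(1 / 2) < a.re) (m : ℕ) :
    ∫ θ in (0 : ℝ)..Real.pi, ((1 + Real.cos θ : ℝ) : ℂ) ^ a * cos ((a + 1 + m) * θ) = 0 := by
  have h' : -1 < (2 * a).re := by simp; linarith
  have := cosIntegral_half_add h' m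
  rw [mul_div_cancel_left₀ _ two_ne_zero] at this
  rw [integral_one_add_cos_cpow_mul_cos, this, mul_zero]

/-! ### The mixed integral representation -/

theorem fracPart_re_gt (μ : ℂ) : -(1 / 2) < (fracPart μ).re := by
  have h := Int.ceil_lt_add_one (μ.re - 1 / 2)
  simp only [fracPart, sub_re, intCast_re, nearestInt]
  linarith

theorem fracPart_add_intCast (μ : ℂ) (k : ℤ) : fracPart (μ + k) = fracPart μ := by
  rw [fracPart, fracPart, add_re, intCast_re, nearestInt_add_intCast]
  push_cast
  ring

theorem fracPart_intCast (m : ℤ) : fracPart m = 0 := by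
  rw [fracPart, intCast_re, nearestInt_intCast, sub_self]

/-- The factor `e^{-iz cos θ} P(ν, -iz(1 + cos θ))` common to all integrands. -/
def incGammaKernel (ν z : ℂ) (θ : ℝ) : ℂ :=
  exp (-I * z * (Real.cos θ : ℂ)) * gammaP ν (-I * z * (1 + (Real.cos θ : ℂ)))

theorem derivIntegrand_eq (n : ℕ) (μ z : ℂ) (θ : ℝ) :
    derivIntegrand n μ z θ =
      incGammaKernel (fracPart μ) z θ * (Real.cos θ : ℂ) ^ n * cos (μ * θ) := rfl

/-- The entire factor in the expansion of the kernel in powers of `1 + cos θ`. -/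
def kernelSeries (ν z : ℂ) (θ : ℝ) : ℂ :=
  ∑' k : ℕ, (-I * z) ^ k * (Gamma (ν + k + 1))⁻¹ * ((1 + Real.cos θ : ℝ) : ℂ) ^ k

/-- The factor `e^{-w}` from `γ*` with `w = -iz(1+cos θ)` cancels the `θ`-dependence of `e^{-iz cos
θ}`, leaving `e^{iz}`. -/
theorem incGammaKernel_eq {ν : ℂ} (hν : -(1 / 2) < ν.re) (z : ℂ) (θ : ℝ) :
    incGammaKernel ν z θ = I ^ (-ν) * z ^ ν * exp (I * z) *
      (((1 + Real.cos θ : ℝ) : ℂ) ^ ν * kernelSeries ν z θ) := by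
  have hν' : ∀ m : ℕ, ν ≠ -(m + 1) := fun m hm => by
    rw [hm] at hν
    simp at hν
    have : (0 : ℝ) ≤ m := m.cast_nonneg
    linarith
  have ht : 0 ≤ 1 + Real.cos θ := by linarith [Real.neg_one_le_cos θ]
  have e1 : -I * z * (1 + (Real.cos θ : ℂ)) = -I * (((1 + Real.cos θ : ℝ) : ℂ) * z) := by
    push_cast; ring
  have e2 : ∑' k : ℕ, (-I * (((1 + Real.cos θ : ℝ) : ℂ) * z)) ^ k * (Gamma (ν + k + 1))⁻¹ =
      kernelSeries ν z θ := by
    refine tsum_congr fun k => ?_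
    simp only [mul_pow]
    ring
  have e3 : exp (-I * z * (Real.cos θ : ℂ)) * exp (-(-I * (((1 + Real.cos θ : ℝ) : ℂ) * z))) =
      exp (I * z) := by
    rw [← exp_add]
    congr 1
    push_cast
    ring
  rw [incGammaKernel, gammaP, e1, branchPow_neg_I_mul, ofReal_mul_cpow ht,
    gammaStar_eq_exp_mul_tsum hν', e2, ← e3]
  ring

theorem norm_kernelSeries_term_le (ν z : ℂ) (θ : ℝ) (k : ℕ) :
    ‖(-I * z) ^ k * (Gamma (ν + k + 1))⁻¹ * ((1 + Real.cos θ : ℝ) : ℂ) ^ k‖ ≤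
      ‖(2 * z) ^ k * (Gamma (ν + k + 1))⁻¹‖ := by
  have ht : ‖((1 + Real.cos θ : ℝ) : ℂ)‖ ≤ 2 := by
    rw [norm_real, Real.norm_of_nonneg (by linarith [Real.neg_one_le_cos θ])]
    linarith [Real.cos_le_one θ]
  rw [mul_right_comm, ← mul_pow, norm_mul, norm_mul, norm_pow, norm_pow]
  gcongr
  rw [norm_mul, norm_mul, norm_neg, norm_mul, norm_I, one_mul, mul_comm, Complex.norm_ofNat]
  gcongr

theorem continuous_kernelSeries (ν z : ℂ) : Continuous (kernelSeries ν z) := by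
  refine continuous_tsum (fun k => ?_) (summable_norm_pow_mul_inv_Gamma ν (2 * z))
    fun k θ => norm_kernelSeries_term_le ν z θ k
  fun_prop

theorem intervalIntegrable_incGammaKernel {ν : ℂ} (hν : -(1 / 2) < ν.re) (z : ℂ) :
    IntervalIntegrable (incGammaKernel ν z) volume 0 Real.pi := by
  rw [funext (incGammaKernel_eq hν z)]
  exact ((intervalIntegrable_one_add_cos_cpow hν).mul_continuousOn
    (continuous_kernelSeries ν z).continuousOn).const_mul _

theorem intervalIntegrable_derivIntegrand (n : ℕ) (μ z : ℂ) :
    IntervalIntegrable (derivIntegrand n μ z) volume 0 Real.pi := by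
  rw [funext (derivIntegrand_eq n μ z)]
  refine ((intervalIntegrable_incGammaKernel (fracPart_re_gt μ) z).mul_continuousOn
    ?_).mul_continuousOn (continuous_cos_mul μ).continuousOn
  fun_prop

theorem hasSum_integral_incGammaKernel {ν : ℂ} (hν : -(1 / 2) < ν.re) (μ z : ℂ) :
    HasSum (fun k : ℕ => (-I * z) ^ k * (Gamma (ν + k + 1))⁻¹ *
        ∫ θ in (0 : ℝ)..Real.pi, ((1 + Real.cos θ : ℝ) : ℂ) ^ (ν + k) * cos (μ * θ))
      (∫ θ in (0 : ℝ)..Real.pi,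
        ((1 + Real.cos θ : ℝ) : ℂ) ^ ν * cos (μ * θ) * kernelSeries ν z θ) := by
  have hg : IntervalIntegrable (fun θ : ℝ => ((1 + Real.cos θ : ℝ) : ℂ) ^ ν * cos (μ * θ))
      volume 0 Real.pi :=
    (intervalIntegrable_one_add_cos_cpow hν).mul_continuousOn (continuous_cos_mul μ).continuousOn
  have hsum := summable_norm_pow_mul_inv_Gamma ν (2 * z)
  have hF : ∀ k : ℕ, (-I * z) ^ k * (Gamma (ν + k + 1))⁻¹ *
      ∫ θ in (0 : ℝ)..Real.pi, ((1 + Real.cos θ : ℝ) : ℂ) ^ (ν + k) * cos (μ * θ) =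
      ∫ θ in (0 : ℝ)..Real.pi, ((1 + Real.cos θ : ℝ) : ℂ) ^ ν * cos (μ * θ) *
        ((-I * z) ^ k * (Gamma (ν + k + 1))⁻¹ * ((1 + Real.cos θ : ℝ) : ℂ) ^ k) := by
    intro k
    rw [← intervalIntegral.integral_const_mul]
    refine integral_congr fun θ _ => ?_
    have : ((1 + Real.cos θ : ℝ) : ℂ) ^ (ν + k) =
        ((1 + Real.cos θ : ℝ) : ℂ) ^ ν * ((1 + Real.cos θ : ℝ) : ℂ) ^ k := by
      -- Where the base vanishes, splitting the power needs `ν + k ≠ 0` for `k ≥ 1`; `Re ν > -1/2`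
      -- ensures this.
      rcases eq_or_ne ((1 + Real.cos θ : ℝ) : ℂ) 0 with h0 | h0
      · rcases Nat.eq_zero_or_pos k with rfl | hk
        · simp
        · have hne : ν + k ≠ 0 := by
            intro h
            have := congrArg re h
            simp at this
            have hk' : (1 : ℝ) ≤ k := by exact_mod_cast hk
            linarith
          rw [h0, zero_cpow hne, zero_pow hk.ne', mul_zero]
      · rw [cpow_add _ _ h0, cpow_natCast]
    rw [this]
    ring
  simp only [hF]
  refine hasSum_integral_of_dominated_convergence
    (fun k θ => ‖((1 + Real.cos θ : ℝ) : ℂ) ^ ν * cos (μ * θ)‖ *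
      ‖(2 * z) ^ k * (Gamma (ν + k + 1))⁻¹‖) (fun k => ?_) (fun k => ?_) ?_ ?_ ?_
  · refine (IntervalIntegrable.mul_continuousOn hg ?_).def'.aestronglyMeasurable
    fun_prop
  · refine Filter.Eventually.of_forall fun θ _ => ?_
    rw [norm_mul]
    exact mul_le_mul_of_nonneg_left (norm_kernelSeries_term_le ν z θ k) (norm_nonneg _)
  · exact Filter.Eventually.of_forall fun θ _ => hsum.mul_left _
  · simp only [tsum_mul_left]
    exact hg.norm.mul_const _
  · refine Filter.Eventually.of_forall fun θ _ => HasSum.mul_left _ ?_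
    exact (Summable.of_norm_bounded hsum (norm_kernelSeries_term_le ν z θ)).hasSum

theorem integral_incGammaKernel_mul_cos {ν : ℂ} (hν : -(1 / 2) < ν.re) (μ z : ℂ) :
    ∫ θ in (0 : ℝ)..Real.pi, incGammaKernel ν z θ * cos (μ * θ) =
      I ^ (-ν) * z ^ ν * exp (I * z) * ∑' k : ℕ, (-I * z) ^ k * (Gamma (ν + k + 1))⁻¹ *
        ∫ θ in (0 : ℝ)..Real.pi, ((1 + Real.cos θ : ℝ) : ℂ) ^ (ν + k) * cos (μ * θ) := by
  rw [(hasSum_integral_incGammaKernel hν μ z).tsum_eq, ← intervalIntegral.integral_const_mul]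
  refine integral_congr fun θ _ => ?_
  rw [incGammaKernel_eq hν]
  ring

theorem besselJ_eq_kummer (μ z : ℂ) :
    besselJ μ z = (z / 2) ^ μ * (exp (I * z) *
      ∑' l : ℕ, (-I * z / 2) ^ l * kummerCoeff μ l) := by
  rw [besselJ, (kummer_transformation μ (-I * z / 2)).2, ← mul_assoc (exp _), ← exp_add,
    show I * z + 2 * (-I * z / 2) = 0 by ring, exp_zero, one_mul]
  congr 1
  refine tsum_congr fun k => ?_
  rw [show (-I * z / 2) ^ 2 = -1 * (z / 2) ^ 2 by rw [div_pow, mul_pow, neg_sq, I_sq]; ring,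
    mul_pow, pow_mul]

/-- The integrals that occur as coefficients, in terms of Kummer's coefficients. -/
theorem inv_Gamma_mul_integral {μ : ℂ} (l : ℕ) (h : -(1 / 2) < (μ + l).re) :
    (Gamma (μ + l + 1))⁻¹ *
      ∫ θ in (0 : ℝ)..Real.pi, ((1 + Real.cos θ : ℝ) : ℂ) ^ (μ + l) * cos (μ * θ) =
      Real.pi * (2 ^ μ)⁻¹ * ((2 ^ l)⁻¹ * kummerCoeff μ l) := by
  rw [integral_one_add_cos_cpow_add_natCast l h, cpow_neg, cpow_add _ _ two_ne_zero, cpow_natCast,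
    kummerCoeff, mul_inv]
  ring

theorem I_cpow_ne_zero (a : ℂ) : I ^ a ≠ 0 := by
  simp [cpow_eq_zero_iff]

theorem pi_ne_zero' : (Real.pi : ℂ) ≠ 0 := ofReal_ne_zero.2 Real.pi_ne_zero

/-- The representation for nonnegative nearest integer `⟨Re μ⟩`, where no correction is needed. -/
theorem besselJ_eq_integral_of_nonneg {μ z : ℂ} (h : z ≠ 0 ∨ ∃ m : ℤ, μ = m)
    (hN : 0 ≤ nearestInt μ.re) :
    besselJ μ z = I ^ μ / Real.pi *
      ∫ θ in (0 : ℝ)..Real.pi, incGammaKernel (fracPart μ) z θ * cos (μ * θ) := by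
  have hν := fracPart_re_gt μ
  obtain ⟨p, hp⟩ := Int.eq_ofNat_of_zero_le hN
  have hμ : μ = fracPart μ + p := by rw [fracPart, hp]; push_cast; ring
  have hzpow : z ^ μ = z ^ fracPart μ * z ^ p := by
    -- At `z = 0` the power would not split in general, but for integer `μ` the fractional part is
    -- `0`.
    rcases h with h | ⟨m, rfl⟩
    · conv_lhs => rw [hμ]
      rw [cpow_add _ _ h, cpow_natCast]
    · conv_lhs => rw [hμ]
      rw [fracPart_intCast, zero_add, cpow_zero, one_mul, cpow_natCast]
  have hIpow : I ^ μ = I ^ fracPart μ * I ^ p := by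
    conv_lhs => rw [hμ]
    rw [cpow_add _ _ I_ne_zero, cpow_natCast]
  rw [integral_incGammaKernel_mul_cos hν,
    ← (hasSum_integral_incGammaKernel hν μ z).summable.sum_add_tsum_nat_add p,
    Finset.sum_eq_zero, zero_add]
  · have hterm : ∀ l : ℕ, (-I * z) ^ (l + p) * (Gamma (fracPart μ + (l + p : ℕ) + 1))⁻¹ *
        ∫ θ in (0 : ℝ)..Real.pi,
          ((1 + Real.cos θ : ℝ) : ℂ) ^ (fracPart μ + (l + p : ℕ)) * cos (μ * θ) =
        (-I * z) ^ p * Real.pi * (2 ^ μ)⁻¹ * ((-I * z / 2) ^ l * kummerCoeff μ l) := by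
      intro l
      have hre : -(1 / 2) < (μ + l).re := by
        rw [hμ]
        simp only [add_re, natCast_re]
        have h1 : (0 : ℝ) ≤ p := p.cast_nonneg
        have h2 : (0 : ℝ) ≤ l := l.cast_nonneg
        linarith
      rw [show fracPart μ + (l + p : ℕ) = μ + l by
        conv_rhs => rw [hμ]
        push_cast; ring, mul_assoc, inv_Gamma_mul_integral l hre, div_pow, pow_add]
      field_simp
    rw [tsum_congr hterm, tsum_mul_left, besselJ_eq_kummer, div_two_cpow, hzpow, hIpow, cpow_neg,
      mul_pow]
    have g1 := two_cpow_ne_zero μ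
    have g2 := I_cpow_ne_zero (fracPart μ)
    have g3 := pi_ne_zero'
    have g4 : I ^ p * (-I) ^ p = 1 := by rw [← mul_pow, mul_neg, I_mul_I, neg_neg, one_pow]
    generalize ∑' l : ℕ, (-I * z / 2) ^ l * kummerCoeff μ l = S
    generalize I ^ fracPart μ = A at *
    generalize (2 : ℂ) ^ μ = B at *
    generalize I ^ p = C at *
    generalize (-I) ^ p = D at *
    field_simp
    linear_combination (-(z ^ fracPart μ * z ^ p * S)) * g4
  · intro k hk
    have hk' : k < p := by simpa using hk
    -- For `k < p` the frequency `μ` exceeds the exponent `ν + k` by a positive integer, so Cauchy's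
    -- integral is zero.
    obtain ⟨m, hm⟩ : ∃ m, p = k + 1 + m := ⟨p - k - 1, by omega⟩
    have hre : -(1 / 2) < (fracPart μ + k).re := by
      simp only [add_re, natCast_re]
      have h2 : (0 : ℝ) ≤ k := k.cast_nonneg
      linarith
    have := integral_one_add_cos_cpow_eq_zero hre m
    rw [show fracPart μ + k + 1 + m = μ by
      conv_rhs => rw [hμ, hm]
      push_cast; ring] at this
    rw [this, mul_zero]

/-- Here `{μ} = μ + p` with `p = -⟨Re μ⟩`, so the integral supplies the terms `l ≥ p` of Kummer's
series and `χ_μ` the first `p`. -/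
theorem besselJ_eq_integral_of_neg {μ z : ℂ} (hz : z ≠ 0) (hN : nearestInt μ.re < 0) :
    besselJ μ z = I ^ μ / Real.pi *
      (∫ θ in (0 : ℝ)..Real.pi, incGammaKernel (fracPart μ) z θ * cos (μ * θ)) + chi μ z := by
  have hν := fracPart_re_gt μ
  obtain ⟨p, hp⟩ := Int.eq_ofNat_of_zero_le (neg_nonneg.2 hN.le)
  have hμ : fracPart μ = μ + p := by
    rw [fracPart, show nearestInt μ.re = -(p : ℤ) by omega]; push_cast; ring
  rw [hμ] at hν
  rw [chi_eq_of_ne_zero μ hz, besselJ_eq_kummer, hp, Int.toNat_natCast,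
    ← (kummer_transformation μ (-I * z / 2)).1.of_norm.sum_add_tsum_nat_add p, hμ,
    integral_incGammaKernel_mul_cos hν]
  have hterm : ∀ k : ℕ, (-I * z) ^ k * (Gamma (μ + p + k + 1))⁻¹ *
      ∫ θ in (0 : ℝ)..Real.pi, ((1 + Real.cos θ : ℝ) : ℂ) ^ (μ + p + k) * cos (μ * θ) =
      ((-I * z) ^ p)⁻¹ * Real.pi * (2 ^ μ)⁻¹ *
        ((-I * z / 2) ^ (k + p) * kummerCoeff μ (k + p)) := by
    intro k
    have hre : -(1 / 2) < (μ + (k + p : ℕ)).re := by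
      have h2 : (0 : ℝ) ≤ k := k.cast_nonneg
      simp only [add_re, natCast_re] at hν ⊢
      push_cast
      linarith
    have g5 : (-I * z) ^ p ≠ 0 := pow_ne_zero _ (mul_ne_zero (neg_ne_zero.2 I_ne_zero) hz)
    rw [show μ + p + k = μ + (k + p : ℕ) by push_cast; ring, mul_assoc,
      inv_Gamma_mul_integral _ hre, div_pow, pow_add (-I * z)]
    field_simp
  rw [tsum_congr hterm, tsum_mul_left, div_two_cpow, cpow_neg, cpow_add _ _ hz,
    cpow_add _ _ I_ne_zero, cpow_natCast, cpow_natCast, mul_pow]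
  have g1 := two_cpow_ne_zero μ
  have g2 := I_cpow_ne_zero μ
  have g3 := pi_ne_zero'
  have g4 : I ^ p * (-I) ^ p = 1 := by rw [← mul_pow, mul_neg, I_mul_I, neg_neg, one_pow]
  have g5 : z ^ p ≠ 0 := pow_ne_zero _ hz
  have g6 : (-I) ^ p = (I ^ p)⁻¹ := eq_inv_of_mul_eq_one_right g4
  have g7 : I ^ p ≠ 0 := pow_ne_zero _ I_ne_zero
  rw [g6]
  generalize ∑' k : ℕ, (-I * z / 2) ^ (k + p) * kummerCoeff μ (k + p) = S
  generalize I ^ μ = A at *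
  generalize (2 : ℂ) ^ μ = B at *
  generalize I ^ p = C at *
  field_simp
  ring

theorem besselJ_eq_integral_add_chi {μ z : ℂ} (h : z ≠ 0 ∨ ∃ m : ℤ, μ = m) :
    besselJ μ z = I ^ μ / Real.pi *
      (∫ θ in (0 : ℝ)..Real.pi, incGammaKernel (fracPart μ) z θ * cos (μ * θ)) + chi μ z := by
  rcases le_or_gt 0 (nearestInt μ.re) with hN | hN
  · have hchi : chi μ z = 0 := by
      rw [chi, if_neg]
      intro hre
      rw [nearestInt, ← Int.sub_one_lt_iff, Int.lt_ceil] at hN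
      push_cast at hN
      linarith
    rw [hchi, add_zero]
    exact besselJ_eq_integral_of_nonneg h hN
  · rcases h with h | ⟨m, rfl⟩
    · exact besselJ_eq_integral_of_neg h hN
    · rw [intCast_re, nearestInt_intCast] at hN
      obtain ⟨p, hp⟩ := Int.eq_ofNat_of_zero_le (neg_nonneg.2 hN.le)
      obtain rfl : m = -(p : ℤ) := by omega
      -- Since `z = 0` is allowed for integer order, the case `-p` is reflected to `p`; cosine is
      -- even and `I^{-p} = (-1)^p I^p` supplies the sign.
      have hpos := besselJ_eq_integral_of_nonneg (μ := (p : ℤ)) (z := z) (Or.inr ⟨p, rfl⟩)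
        (by rw [intCast_re, nearestInt_intCast]; omega)
      rw [fracPart_intCast] at hpos
      rw [chi_intCast, add_zero, fracPart_intCast]
      push_cast at hpos ⊢
      rw [besselJ_neg_natCast, hpos]
      simp only [neg_mul, cos_neg]
      have hI : I ^ (-(p : ℂ)) = (-1) ^ p * I ^ (p : ℂ) := by
        rw [cpow_neg, cpow_natCast, ← inv_pow, inv_I, ← neg_one_mul, mul_pow]
      rw [hI]
      ring

/-! ### Assembling the formula for the `n`-th derivative -/

theorem cos_pow_mul_cos_mul (n : ℕ) (μ θ : ℂ) :
    cos θ ^ n * cos (μ * θ) = 1 / 2 ^ n * ∑ j ∈ Finset.range (n + 1),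
      (n.choose j : ℂ) * cos ((μ - n + 2 * j) * θ) := by
  have key := eq_sum_choose_of_recursion (S := Set.univ) (σ := 1) (u := -1) (v := 1)
    (G := fun n μ => 2 ^ n * (cos θ ^ n * cos (μ * θ))) (by simp) (by simp) ?_ n μ (Set.mem_univ _)
  · rw [one_div, eq_inv_mul_iff_mul_eq₀ (pow_ne_zero _ two_ne_zero), key]
    refine Finset.sum_congr rfl fun j _ => ?_
    simp only [one_pow, one_mul, pow_zero]
    ring_nf
  · intro n x _
    rw [show (x + -1) * θ = x * θ - θ by ring, show (x + 1) * θ = x * θ + θ by ring, cos_sub,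
      cos_add]
    ring

theorem integral_derivIntegrand (n : ℕ) (μ z : ℂ) :
    ∫ θ in (0 : ℝ)..Real.pi, derivIntegrand n μ z θ =
      1 / 2 ^ n * ∑ j ∈ Finset.range (n + 1), (n.choose j : ℂ) *
        ∫ θ in (0 : ℝ)..Real.pi,
          incGammaKernel (fracPart μ) z θ * cos ((μ - n + 2 * j) * θ) := by
  simp only [← intervalIntegral.integral_const_mul]
  rw [← intervalIntegral.integral_finsetSum, ← intervalIntegral.integral_const_mul]
  · refine integral_congr fun θ _ => ?_
    rw [derivIntegrand_eq, mul_assoc, ofReal_cos, cos_pow_mul_cos_mul, Finset.mul_sum,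
      Finset.mul_sum, Finset.mul_sum]
    refine Finset.sum_congr rfl fun j _ => ?_
    ring
  · intro j _
    exact ((intervalIntegrable_incGammaKernel (fracPart_re_gt μ) z).mul_continuousOn
      (continuous_cos_mul _).continuousOn).const_mul _

theorem iteratedDeriv_besselJ_eq {μ z : ℂ} (n : ℕ) (h : IsRegular μ z) :
    iteratedDeriv n (besselJ μ) z = I ^ (μ - n) / (Real.pi : ℂ) *
      (∫ θ in (0 : ℝ)..Real.pi, derivIntegrand n μ z θ) + derivSum n μ z := by
  rw [iteratedDeriv_besselJ n h, integral_derivIntegrand, derivSum, mul_left_comm, ← mul_add]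
  congr 1
  rw [Finset.mul_sum, ← Finset.sum_add_distrib]
  refine Finset.sum_congr rfl fun j _ => ?_
  have hshift : μ - n + 2 * j = μ + ((2 * j - n : ℤ) : ℂ) := by push_cast; ring
  have hreg : z ≠ 0 ∨ ∃ m : ℤ, μ - n + 2 * j = m := by
    have := h.add_intCast (2 * j - n)
    rw [← hshift] at this
    exact this.imp_left slitPlane_ne_zero
  have hI : I ^ (μ - n + 2 * j) = I ^ (μ - n) * (-1) ^ j := by
    rw [cpow_add _ _ I_ne_zero, show (2 * j : ℂ) = (2 * j : ℕ) by push_cast; ring, cpow_natCast,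
      pow_mul, I_sq]
  -- The sign from the derivative recursion cancels the one from `I^{2j}` in the integral part; in
  -- the `χ` part it remains.
  have hj : ((-1 : ℂ) ^ j) * (-1) ^ j = 1 := by rw [← mul_pow]; simp
  rw [besselJ_eq_integral_add_chi hreg, hI, show fracPart (μ - n + 2 * j) = fracPart μ by
    rw [hshift, fracPart_add_intCast]]
  linear_combination (I ^ (μ - n) / (Real.pi : ℂ) * (n.choose j : ℂ) *
    ∫ θ in (0 : ℝ)..Real.pi, incGammaKernel (fracPart μ) z θ * cos ((μ - n + 2 * j) * θ)) * hj

theorem derivSum_eq_zero {n : ℕ} {μ : ℂ} (z : ℂ) (h : (n : ℤ) ≤ nearestInt μ.re) :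
    derivSum n μ z = 0 := by
  rw [derivSum, Finset.sum_eq_zero, mul_zero]
  intro j _
  rw [chi, if_neg, mul_zero]
  -- The hypothesis amounts to `Re μ - n > -1/2`, so every order `μ - n + 2j` lies where `χ` is zero
  -- by definition.
  rw [nearestInt, ← Int.sub_one_lt_iff, Int.lt_ceil] at h
  push_cast at h
  have hj : (0 : ℝ) ≤ j := j.cast_nonneg
  simp
  linarith

end

end BesselMixed

theorem mainTheorem10 (n : ℕ) (μ z : ℂ) (hz : z ∈ Complex.slitPlane ∨ ∃ m : ℤ, μ = (m : ℂ)) :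
    AnalyticAt ℂ (BesselMixed.besselJ μ) z ∧
    IntervalIntegrable (BesselMixed.derivIntegrand n μ z) MeasureTheory.volume 0 Real.pi ∧
    iteratedDeriv n (BesselMixed.besselJ μ) z =
      Complex.I ^ (μ - n) / (Real.pi : ℂ) *
          (∫ θ in (0 : ℝ)..Real.pi, BesselMixed.derivIntegrand n μ z θ) +
        BesselMixed.derivSum n μ z ∧
    ((n : ℤ) ≤ BesselMixed.nearestInt μ.re → BesselMixed.derivSum n μ z = 0) :=
  ⟨BesselMixed.IsRegular.analyticAt_besselJ hz,
    BesselMixed.intervalIntegrable_derivIntegrand n μ z,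
    BesselMixed.iteratedDeriv_besselJ_eq n hz,
    BesselMixed.derivSum_eq_zero z⟩
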